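/- Let $k\ge 1$, $m=2k+1$, and let $\mathbf q(X)=\sum_{1\le i\le j\le m}q_{ij}x_ix_j$ be a quadratic form with coefficients $q_{ij}\in\mathbb Z$. Its matrix is $Q=(q_{ij})+{}^t(q_{ij})$ (with $q_{ij}=0$ for $i>j$), so that $2\mathbf q(X)={}^tXQX$, and $\det\mathbf q:=\det Q$. Assume that $\mathbf q$ is nonsingular, i.e. $\det\mathbf q\neq 0$, and let $p$ be a prime not dividing $\det\mathbf q$ (such a $p$ is odd, since $\det\mathbf q$ is even for odd $m$). Let $\Lambda^m=GL_m(\mathbb Z)$. For $1\le d\le k$ put $b=m-2d$ and $$D_p(d)=\mathrm{diag}(1_d,\;p\,1_b,\;p^2 1_d),$$ where $1_n$ is the unit matrix of order $n$. For an integral $m\times m$ matrix $M$ let $\mathbf q[M]$ be the form $Y\mapsto \mathbf q(MY)$; write $\mathbf q[M]\equiv 0\ (\mathrm{mod}\ p^2)$ if $\mathbf q[M]=p^2\mathbf q'$ for a quadratic form $\mathbf q'$ with integer coefficients, and $M\mid K$ if $K=ML$ for some $L\in\mathbb Z^m$. For $K\in\mathbb Z^m$ let $$\mathcal S_{p^2}(\mathbf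 q,D_p(d),K)=\#\{M\Lambda^m\in\Lambda^mD_p(d)\Lambda^m/\Lambda^m\;:\;\mathbf q[M]\equiv 0\ (\mathrm{mod}\ p^2),\ M\mid K\}.$$ **Theorem 1.9.** For every $d$ with $1\le d\le k$ and every $K\in\mathbb Z^m$ with $\mathbf q(K)\equiv 0\ (\mathrm{mod}\ p^2)$, the number $\mathcal S_{p^2}(\mathbf q,D_p(d),K)$ is finite and $$\mathcal S_{p^2}(\mathbf q,D_p(d),K)=\alpha_p(d)\cdot\Bigl\{1+\bigl(\varepsilon_p\,\chi_{\mathbf q}(p)\,p^{k-1}+\kappa_p(d)\bigr)\,\delta_{(p^{-1}K)}+p^{m-2}\,\delta_{(p^{-2}K)}\Bigr\}.$$ Here $\delta_{(X)}=1$ if the column $X\in\mathbb Q^m$ is integral and $\delta_{(X)}=0$ otherwise; $\varepsilon_p$ and $\chi_{\mathbf q}(p)$ are the Legendre symbols $$\varepsilon_p=\Bigl(\frac{2\,\mathbf q(p^{-1}K)}{p}\Bigr),\qquad \chi_{\mathbf q}(p)=\Bigl(\frac{(-1)^k\det\mathbf q}{p}\Bigr)$$ (note that $\mathbf q(p^{-1}K)=p^{-2}\mathbf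 q(K)\in\mathbb Z$; the Legendre symbol of a multiple of $p$ is $0$); and $$\alpha_p(d)=p^{1-d}\prod_{s=1}^{d-1}\frac{p^{2(k-s)}-1}{1-p^{-s}},\qquad \kappa_p(d)=\frac{p^{m-2}-p^{d-1}}{p^d-1}-1 .$$ -/

import Mathlib

namespace IsotropicSum

/-- The matrix `Q` of an integral quadratic form `q` in `m` variables, so that
`Q i j = q (e i + e j) - q (e i) - q (e j)`. If `q X = ∑_{i ≤ j} c i j * X i * X j`, then `Q` is the sum
of `(c i j)` and its transpose, and `2 * q X = Xᵀ Q X`. -/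
def formMatrix {m : ℕ} (q : QuadraticForm ℤ (Fin m → ℤ)) : Matrix (Fin m) (Fin m) ℤ :=
  Matrix.of fun i j => QuadraticMap.polar q (Pi.single i 1) (Pi.single j 1)

/-- The determinant of an integral quadratic form: the determinant of its matrix. -/
def formDet {m : ℕ} (q : QuadraticForm ℤ (Fin m → ℤ)) : ℤ :=
  (formMatrix q).det

/-- The form `q[M]`, which is `Y ↦ q (M Y)`. -/
def changeVars {m : ℕ} (q : QuadraticForm ℤ (Fin m → ℤ)) (M : Matrix (Fin m) (Fin m) ℤ) :
    QuadraticForm ℤ (Fin m → ℤ) :=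
  q.comp M.mulVecLin

/-- An integral quadratic form is congruent to `0` modulo `a` if it is `a` times an
integral quadratic form. -/
def FormCongrZero {m : ℕ} (a : ℤ) (q : QuadraticForm ℤ (Fin m → ℤ)) : Prop :=
  ∃ q' : QuadraticForm ℤ (Fin m → ℤ), q = a • q'

/-- The matrix `diag(1_d, p 1_b, p² 1_d)` of order `m = 2 d + b` (used for `2 d ≤ m`). -/
def elemDivMatrix (p m d : ℕ) : Matrix (Fin m) (Fin m) ℤ :=
  Matrix.diagonal fun i =>
    if (i : ℕ) < d then 1 else if (i : ℕ) < d + (m - 2 * d) then (p : ℤ) else (p : ℤ) ^ 2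

/-- The double coset `Λ D Λ`, where `Λ = GL_m(ℤ)`. -/
def unimodularDoubleCoset {m : ℕ} (D : Matrix (Fin m) (Fin m) ℤ) :
    Set (Matrix (Fin m) (Fin m) ℤ) :=
  {M | ∃ U V : GL (Fin m) ℤ, M = U.1 * D * V.1}

/-- The coset `M Λ`, where `Λ = GL_m(ℤ)`. -/
def unimodularCoset {m : ℕ} (M : Matrix (Fin m) (Fin m) ℤ) : Set (Matrix (Fin m) (Fin m) ℤ) :=
  {N | ∃ V : GL (Fin m) ℤ, N = M * V.1}

/-- The square matrix `M` divides the column `K` from the left. -/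
def DividesColumn {m : ℕ} (M : Matrix (Fin m) (Fin m) ℤ) (K : Fin m → ℤ) : Prop :=
  ∃ L : Fin m → ℤ, K = M.mulVec L

/-- The cosets `M Λ` contained in `Λ D Λ` with `q[M] ≡ 0 (mod a)` and `M ∣ K`.
Both conditions depend only on the coset. -/
def isotropicCosets {m : ℕ} (a : ℤ) (q : QuadraticForm ℤ (Fin m → ℤ))
    (D : Matrix (Fin m) (Fin m) ℤ) (K : Fin m → ℤ) : Set (Set (Matrix (Fin m) (Fin m) ℤ)) :=
  {C | ∃ M ∈ unimodularDoubleCoset D,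
    FormCongrZero a (changeVars q M) ∧ DividesColumn M K ∧ C = unimodularCoset M}

/-- The isotropic sum: the number of the above cosets. -/
noncomputable def isotropicSum {m : ℕ} (a : ℤ) (q : QuadraticForm ℤ (Fin m → ℤ))
    (D : Matrix (Fin m) (Fin m) ℤ) (K : Fin m → ℤ) : ℕ :=
  (isotropicCosets a q D K).ncard

/-- The quadratic character `χ_q(p) = ((-1)^k det q / p)` of a form in `2 k + 1` variables. -/
def formChar (p : ℕ) [Fact p.Prime] {k : ℕ} (q : QuadraticForm ℤ (Fin (2 * k + 1) → ℤ)) : ℤ :=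
  legendreSym p ((-1) ^ k * formDet q)

/-- The Legendre symbol `ε_p(a) = (2 a / p)`. -/
def epsilonSymbol (p : ℕ) [Fact p.Prime] (a : ℤ) : ℤ :=
  legendreSym p (2 * a)

open Classical in
/-- The generalized Kronecker symbol of a rational column: `1` if it is integral and
`0` otherwise. -/
noncomputable def integralDelta {m : ℕ} (X : Fin m → ℚ) : ℚ :=
  if ∀ i, ∃ z : ℤ, X i = z then 1 else 0

/-- `α_p(d) = p^(1-d) ∏_{s=1}^{d-1} (p^(2(k-s)) - 1) / (1 - p^(-s))`. -/
def alphaCoeff (p k d : ℕ) : ℚ :=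
  (p : ℚ) ^ (1 - (d : ℤ)) *
    ∏ s ∈ Finset.Icc 1 (d - 1), ((p : ℚ) ^ (2 * (k - s)) - 1) / (1 - (p : ℚ) ^ (-(s : ℤ)))

/-- `κ_p(d) = (p^(m-2) - p^(d-1)) / (p^d - 1) - 1` with `m = 2 k + 1`. -/
def kappaCoeff (p k d : ℕ) : ℚ :=
  ((p : ℚ) ^ (2 * k + 1 - 2) - (p : ℚ) ^ (d - 1)) / ((p : ℚ) ^ d - 1) - 1

end IsotropicSum

namespace IsotropicSum

/-! ### Counting by fibres. -/

section Counting

/-! A coset `M Λ` is the same thing as the lattice spanned by the columns of `M`. For `M` in the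
double coset this lattice contains `p² ℤ^m`, so it is determined by its image `S` in `(ℤ/p²)^m`. By
Smith normal form the double coset is detected by two orders, `|S| = p^m` and `|S mod p| = p^d`. The
sum therefore counts the subgroups `S` with these orders on which the form vanishes modulo `p²` and
which contain `K` (`isotropicSum_eq`).

Since `p` is odd, any two members of such an `S` are orthogonal. Choose `v_1, …, v_d` in `S`
reducing to a basis of `S mod p`. Then `S` consists exactly of the vectors orthogonal to all `v_i`
whose reduction lies in the span of the reduced `v_i` (`IsNeighbor.eq_frameNeighbor`), and every
such "lift frame" arises. Double counting (`card_neighbors_mul`) expresses the number of `S` as the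
number of lift frames divided by the number of admissible choices inside one `S`.

Lift frames are counted by lifting frames modulo `p` one vector at a time; each lift is governed by
independent linear equations (`card_lift_extension`). Frames modulo `p` are counted in the same way
from the number of isotropic vectors in the ambient space (`card_frame_extension`), and that number
comes from Gauss sums for diagonal forms.

The condition `K ∈ S` produces the cases of the formula. If `p ∤ K`, the vector `K` itself is taken
into the frame, giving `α_p(d)`. If `K = p K'`, the condition says that `K'` is orthogonal to the
frame modulo `p`. For anisotropic `K'` the frames live in the hyperplane orthogonal to `K'`, whose
discriminant supplies `ε_p χ_q(p)`. For isotropic `K'` nonzero modulo `p`, one separates the `S`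
according to whether `K'` lies in `S mod p`. For `K' ≡ 0` there is no condition. In each case the
frame count is a multiple of the product from the primitive case, so the answer is a multiple of
`α_p(d)`. -/

theorem natCard_eq_mul_of_fiber {R α β : Type*} [CommSemiring R] [Finite α] [Finite β] (f : α → β)
    (c : R) (h : ∀ b, (Nat.card {a // f a = b} : R) = c) : (Nat.card α : R) = Nat.card β * c := by
  have := Fintype.ofFinite β
  rw [← Nat.card_congr (Equiv.sigmaFiberEquiv f), Nat.card_sigma]
  simp [h]

/-- The inductive step of all tuple counts: a tuple is built by prepending an entry, and `e` is the
number of choices for it, independent of the tail. -/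
theorem natCard_cons {X : Type*} [Finite X] {n : ℕ} {P : (Fin (n + 1) → X) → Prop}
    {P₀ : (Fin n → X) → Prop} (hP : ∀ x v, P (Fin.cons x v) → P₀ v) (e : ℚ)
    (he : ∀ v, P₀ v → (Nat.card {x // P (Fin.cons x v)} : ℚ) = e) :
    (Nat.card {v // P v} : ℚ) = Nat.card {v // P₀ v} * e := by
  have := Fintype.ofFinite {v // P₀ v}
  have key : Nat.card {v // P v} = Nat.card (Σ v : {v // P₀ v}, {x // P (Fin.cons x v.1)}) := by
    refine Nat.card_congr
      { toFun := fun v => ⟨⟨Fin.tail v.1, hP (v.1 0) _ ?_⟩, ⟨v.1 0, ?_⟩⟩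
        invFun := fun s => ⟨Fin.cons s.2.1 s.1.1, s.2.2⟩
        left_inv := fun v => ?_
        right_inv := fun s => ?_ }
    · rw [Fin.cons_self_tail]; exact v.2
    · simp only [Fin.cons_self_tail]; exact v.2
    · simp
    · rfl
  rw [key, Nat.card_sigma, Nat.cast_sum, Finset.sum_congr rfl fun v _ => he v.1 v.2]
  simp

theorem natCard_subtype_split {X : Type*} [Finite X] (P R : X → Prop) :
    Nat.card {x // P x} = Nat.card {x // P x ∧ R x} + Nat.card {x // P x ∧ ¬ R x} := by
  classical
  rw [← Nat.card_sum]
  refine Nat.card_congr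
    (((Equiv.sumCompl fun x : {x // P x} => R x.1).symm).trans (Equiv.sumCongr ?_ ?_))
  · exact Equiv.subtypeSubtypeEquivSubtypeInter P R
  · exact Equiv.subtypeSubtypeEquivSubtypeInter P fun x => ¬ R x

theorem natCard_fiber_of_surjective {G H : Type*} [AddGroup G] [AddGroup H] [Finite G] [Finite H]
    (f : G →+ H) (hf : Function.Surjective f) (c : H) :
    Nat.card {x // f x = c} * Nat.card H = Nat.card G := by
  have h : ∀ b, Nat.card {x // f x = b} = Nat.card {x // f x = c} := by
    intro b
    obtain ⟨y, hy⟩ := hf (-b + c)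
    refine Nat.card_congr ((Equiv.addRight y).subtypeEquiv fun x => ?_)
    simp only [Equiv.coe_addRight, map_add, hy]
    constructor
    · rintro rfl; simp
    · intro h
      rw [← add_assoc, add_eq_right, add_neg_eq_zero] at h
      exact h
  have := natCard_eq_mul_of_fiber (R := ℕ) f _ h
  simp only [Nat.cast_id] at this
  rw [this, mul_comm]

end Counting

/-! ### Zeros of diagonal quadratic forms over a finite field, by Gauss sums. -/

section Gauss

open Finset

theorem addChar_map_sum {ι A M : Type*} [AddCommMonoid A] [CommMonoid M] (s : Finset ι) (ψ : AddChar A M) (f : ι → A) :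
    ψ (∑ i ∈ s, f i) = ∏ i ∈ s, ψ (f i) :=
  map_prod ψ.toMonoidHom (fun i => Multiplicative.ofAdd (f i)) s

variable {F : Type*} [Field F] [Fintype F] [DecidableEq F] {C : Type*} [Field C] [CharZero C]

theorem card_filter_sq_eq (hF : ringChar F ≠ 2) (a : F) :
    ((univ.filter fun x : F => x ^ 2 = a).card : ℤ) = quadraticChar F a + 1 := by
  rw [← quadraticChar_card_sqrts hF a]
  congr 2
  ext x; simp

/-- Each `y` has `1 + χ(y)` square roots. The constant part sums to zero because `a ≠ 0`, and the
substitution `y ↦ a y` turns the rest into the Gauss sum, up to `χ(a) = χ(a)⁻¹`. -/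
theorem sum_addChar_mul_sq (hF : ringChar F ≠ 2) {ψ : AddChar F C} (hψ : ψ.IsPrimitive)
    {a : F} (ha : a ≠ 0) :
    ∑ x : F, ψ (a * x ^ 2) = quadraticChar F a *
      gaussSum ((quadraticChar F).ringHomComp (Int.castRingHom C)) ψ := by
  have h1 : ∑ x : F, ψ (a * x ^ 2) = ∑ y : F, ((quadraticChar F y : ℤ) + 1 : C) * ψ (a * y) := by
    rw [← Finset.sum_fiberwise (s := univ) (g := fun x : F => x ^ 2)]
    refine Finset.sum_congr rfl fun y _ => ?_
    rw [Finset.sum_congr rfl (g := fun _ => ψ (a * y))]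
    · rw [Finset.sum_const, nsmul_eq_mul]
      congr 1
      have := card_filter_sq_eq hF y
      exact_mod_cast this
    · intro x hx
      rw [(Finset.mem_filter.1 hx).2]
  rw [h1]
  simp only [add_mul, one_mul, Finset.sum_add_distrib]
  have h2 : ∑ y : F, ψ (a * y) = 0 := by
    have := AddChar.sum_mulShift a hψ
    simp only [mul_comm _ a, ha, if_false] at this
    simpa using this
  rw [h2, add_zero, gaussSum, Finset.mul_sum,
    ← Equiv.sum_comp (Equiv.mulLeft₀ a ha)
      (fun i => (quadraticChar F a : C) * (((quadraticChar F).ringHomComp (Int.castRingHom C)) i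
        * ψ i))]
  refine Finset.sum_congr rfl fun y _ => ?_
  have h3 := quadraticChar_sq_one ha
  have h4 : ((quadraticChar F a : ℤ) : C) ^ 2 = 1 := by exact_mod_cast h3
  simp only [Equiv.mulLeft₀_apply, MulChar.ringHomComp_apply, map_mul, eq_intCast]
  linear_combination (-(quadraticChar F y : C) * ψ (a * y)) * h4

/-- Orthogonality of characters detects zeros; the exponential sum of a diagonal form factors over
the coordinates. -/
theorem card_mul_card_diagonal_zeros {n : ℕ} (a : Fin n → F) {ψ : AddChar F C}
    (hψ : ψ.IsPrimitive) :
    (Fintype.card F : C) * (univ.filter fun x : Fin n → F => ∑ i, a i * x i ^ 2 = 0).card =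
      ∑ t : F, ∏ i, ∑ y : F, ψ (t * a i * y ^ 2) := by
  have h1 : ∀ t : F, ∏ i, ∑ y : F, ψ (t * a i * y ^ 2) =
      ∑ x : Fin n → F, ψ (t * ∑ i, a i * x i ^ 2) := by
    intro t
    rw [Fintype.prod_sum]
    refine Finset.sum_congr rfl fun x _ => ?_
    rw [Finset.mul_sum, addChar_map_sum]
    simp only [mul_assoc]
  simp only [h1]
  rw [Finset.sum_comm]
  simp only [AddChar.sum_mulShift _ hψ]
  rw [Finset.card_filter, Nat.cast_sum, Finset.mul_sum]
  refine Finset.sum_congr rfl fun x _ => ?_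
  split_ifs <;> simp

theorem card_mul_card_diagonal_zeros_eq {n : ℕ} (hF : ringChar F ≠ 2) (a : Fin n → F)
    (ha : ∀ i, a i ≠ 0) {ψ : AddChar F C} (hψ : ψ.IsPrimitive) :
    (Fintype.card F : C) * (univ.filter fun x : Fin n → F => ∑ i, a i * x i ^ 2 = 0).card =
      (Fintype.card F : C) ^ n + (∑ t ∈ univ.erase (0 : F), (quadraticChar F t : C) ^ n) *
        (quadraticChar F (∏ i, a i) : C) *
        gaussSum ((quadraticChar F).ringHomComp (Int.castRingHom C)) ψ ^ n := by
  rw [card_mul_card_diagonal_zeros a hψ, ← Finset.add_sum_erase _ _ (mem_univ (0 : F))]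
  have h : ∀ t ∈ univ.erase (0 : F), ∏ i, ∑ y : F, ψ (t * a i * y ^ 2) =
      (quadraticChar F t : C) ^ n * ((quadraticChar F (∏ i, a i) : C) *
        gaussSum ((quadraticChar F).ringHomComp (Int.castRingHom C)) ψ ^ n) := by
    intro t ht
    have ht : t ≠ 0 := (Finset.mem_erase.1 ht).1
    rw [Finset.prod_congr rfl fun i _ => sum_addChar_mul_sq hF hψ (mul_ne_zero ht (ha i))]
    simp only [map_mul, Finset.prod_mul_distrib, Int.cast_mul, map_prod, Int.cast_prod]
    simp
    ring
  rw [Finset.sum_congr rfl h, ← Finset.sum_mul]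
  simp
  ring

/-- Values in a field of characteristic zero let the resulting identities be read back in the
integers. -/
theorem exists_primitive_addChar (F : Type*) [Field F] [Fintype F] :
    ∃ (C : Type) (_ : Field C) (_ : CharZero C) (ψ : AddChar F C), ψ.IsPrimitive := by
  have h : ringChar ℚ ≠ ringChar F := by
    rw [ringChar.eq_zero]
    exact (CharP.char_ne_zero_of_finite F (ringChar F)).symm
  let ψ := AddChar.FiniteField.primitiveChar F ℚ h
  exact ⟨CyclotomicField ψ.n ℚ, inferInstance, inferInstance, ψ.char, ψ.prim⟩

/-- An odd power of `χ` is `χ`, which sums to zero, so only the trivial character `t = 0`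
contributes. -/
theorem card_diagonal_zeros_odd (hF : ringChar F ≠ 2) {k : ℕ} (a : Fin (2 * k + 1) → F)
    (ha : ∀ i, a i ≠ 0) :
    Nat.card {x : Fin (2 * k + 1) → F // ∑ i, a i * x i ^ 2 = 0} = Fintype.card F ^ (2 * k) := by
  obtain ⟨C, _, _, ψ, hψ⟩ := exists_primitive_addChar F
  have key := card_mul_card_diagonal_zeros_eq hF a ha hψ
  have h0 : ∑ t ∈ univ.erase (0 : F), (quadraticChar F t : C) ^ (2 * k + 1) = 0 := by
    have h1 : ∀ t : F, (quadraticChar F t) ^ (2 * k + 1) = quadraticChar F t := by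
      intro t
      rcases eq_or_ne t 0 with rfl | ht
      · simp
      · rw [pow_succ, pow_mul, quadraticChar_sq_one ht]; simp
    have h2 := quadraticChar_sum_zero hF
    rw [← Finset.add_sum_erase _ _ (mem_univ (0 : F)), quadraticChar_zero, zero_add] at h2
    calc _ = ((∑ t ∈ univ.erase (0 : F), (quadraticChar F t) ^ (2 * k + 1) : ℤ) : C) := by
          push_cast; rfl
      _ = 0 := by rw [Finset.sum_congr rfl fun t _ => h1 t, h2]; simp
  rw [h0, zero_mul, zero_mul, add_zero] at key
  have hc : (Fintype.card F : C) ≠ 0 := by simp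
  rw [Nat.card_eq_fintype_card, Fintype.card_subtype]
  rw [pow_succ', mul_right_inj' hc] at key
  exact_mod_cast key

/-- Now `χ(t)^(2k) = 1` for all `t ≠ 0`, and the square of the Gauss sum is `χ(-1)` times the order
of the field, which accounts for the sign `(-1)^k`. -/
theorem card_diagonal_zeros_even (hF : ringChar F ≠ 2) {k : ℕ} (hk : 1 ≤ k) (a : Fin (2 * k) → F)
    (ha : ∀ i, a i ≠ 0) :
    (Nat.card {x : Fin (2 * k) → F // ∑ i, a i * x i ^ 2 = 0} : ℤ) =
      (Fintype.card F : ℤ) ^ (2 * k - 1) + quadraticChar F ((-1) ^ k * ∏ i, a i) *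
        ((Fintype.card F : ℤ) ^ k - (Fintype.card F : ℤ) ^ (k - 1)) := by
  obtain ⟨C, _, _, ψ, hψ⟩ := exists_primitive_addChar F
  have key := card_mul_card_diagonal_zeros_eq hF a ha hψ
  have h0 : ∑ t ∈ univ.erase (0 : F), (quadraticChar F t : C) ^ (2 * k) =
      Fintype.card F - 1 := by
    rw [Finset.sum_congr rfl (g := fun _ => (1 : C))]
    · simp only [sum_const, card_erase_of_mem (mem_univ _), card_univ]
      rw [nsmul_one, Nat.cast_sub Fintype.card_pos, Nat.cast_one]
    · intro t ht
      have := quadraticChar_sq_one (Finset.mem_erase.1 ht).1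
      rw [pow_mul]
      norm_cast
      rw [this, one_pow]
  have hg : gaussSum ((quadraticChar F).ringHomComp (Int.castRingHom C)) ψ ^ 2 =
      (quadraticChar F (-1) : C) * Fintype.card F := by
    rw [gaussSum_sq _ _ hψ]
    · simp
    · intro h
      obtain ⟨u, hu⟩ := quadraticChar_exists_neg_one' hF
      have := congrArg (fun χ => χ (u : F)) h
      simp [hu] at this
      norm_num at this
    · exact (quadraticChar_isQuadratic F).comp _
  rw [h0, pow_mul (gaussSum _ _), hg] at key
  have hc : (Fintype.card F : C) ≠ 0 := by simp
  rw [Nat.card_eq_fintype_card, Fintype.card_subtype]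
  have : ((Fintype.card F : C)) * ((univ.filter fun x : Fin (2 * k) → F =>
      ∑ i, a i * x i ^ 2 = 0).card : C) = (Fintype.card F : C) *
      ((Fintype.card F : C) ^ (2 * k - 1) + quadraticChar F ((-1) ^ k * ∏ i, a i) *
        ((Fintype.card F : C) ^ k - (Fintype.card F : C) ^ (k - 1))) := by
    rw [key]
    obtain ⟨j, rfl⟩ : ∃ j, k = j + 1 := ⟨k - 1, by omega⟩
    simp only [map_mul, map_pow, Int.cast_mul, Int.cast_pow, show 2 * (j + 1) - 1 = 2 * j + 1 by omega,
      add_tsub_cancel_right]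
    ring
  exact_mod_cast mul_left_cancel₀ hc this

end Gauss

/-! ### Totally isotropic frames over a finite field. -/

section Frames

open Module

variable {F V : Type*} [Field F] [Finite F] [AddCommGroup V] [Module F V] [Finite V]
  {B : LinearMap.BilinForm F V}

/-- A frame is a linearly independent tuple of vectors whose Gram matrix vanishes. -/
def IsFrame (B : LinearMap.BilinForm F V) {n : ℕ} (w : Fin n → V) : Prop :=
  LinearIndependent F w ∧ ∀ i j, B (w i) (w j) = 0

omit [Finite F] [Finite V] in
theorem isFrame_cons (hs : B.IsSymm) {n : ℕ} (x : V) (w : Fin n → V) :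
    IsFrame B (Fin.cons x w : Fin (n + 1) → V) ↔
      IsFrame B w ∧ (∀ j, B (w j) x = 0) ∧ B x x = 0 ∧ x ∉ Submodule.span F (Set.range w) := by
  simp only [IsFrame, linearIndependent_finCons, Fin.forall_fin_succ, Fin.cons_zero, Fin.cons_succ]
  constructor
  · rintro ⟨⟨h1, h2⟩, ⟨h3, h4⟩, h5⟩
    exact ⟨⟨h1, fun i => (h5 i).2⟩, fun i => (h5 i).1, h3, h2⟩
  · rintro ⟨⟨h1, h2⟩, h3, h4, h5⟩
    exact ⟨⟨h1, h5⟩, ⟨h4, fun i => by rw [hs.eq]; exact h3 i⟩, fun i => ⟨h3 i, h2 i⟩⟩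

-- The functional on the span prescribed by `c` extends to `V` and is represented by a vector, as
-- `B` is nondegenerate.
omit [Finite F] in
theorem exists_apply_eq (hB : B.Nondegenerate) (hs : B.IsSymm) {n : ℕ} {w : Fin n → V}
    (hw : LinearIndependent F w) (c : Fin n → F) : ∃ y, ∀ j, B (w j) y = c j := by
  obtain ⟨g, hg⟩ := ((Basis.span hw).constr F c).exists_extend
  refine ⟨(B.toDual hB).symm g, fun j => ?_⟩
  rw [hs.eq, LinearMap.BilinForm.apply_toDual_symm_apply]
  have h1 := LinearMap.congr_fun hg (Basis.span hw j)
  rw [Basis.constr_basis] at h1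
  rw [← h1]
  simp [Basis.span_apply]

/-- The vectors of `H` orthogonal to all members of a tuple. -/
def orthIn (B : LinearMap.BilinForm F V) (H : Submodule F V) {n : ℕ} (w : Fin n → V) :
    Submodule F V where
  carrier := {x | x ∈ H ∧ ∀ i, B (w i) x = 0}
  add_mem' := fun hx hy => ⟨H.add_mem hx.1 hy.1, fun i => by simp [hx.2 i, hy.2 i]⟩
  zero_mem' := ⟨H.zero_mem, fun i => by simp⟩
  smul_mem' := fun c x hx => ⟨H.smul_mem c hx.1, fun i => by simp [hx.2 i]⟩

omit [Finite F] [Finite V] in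
theorem mem_orthIn {H : Submodule F V} {n : ℕ} {w : Fin n → V} {x : V} :
    x ∈ orthIn B H w ↔ x ∈ H ∧ ∀ i, B (w i) x = 0 := Iff.rfl

theorem card_system {H : Submodule F V} {n : ℕ} {w : Fin n → V}
    (hw : ∀ c : Fin n → F, ∃ y ∈ H, ∀ j, B (w j) y = c j) (c : Fin n → F) :
    Nat.card {y // y ∈ H ∧ ∀ j, B (w j) y = c j} * Nat.card F ^ n = Nat.card H := by
  let f : H →+ (Fin n → F) :=
    { toFun := fun y j => B (w j) y
      map_zero' := by ext; simp
      map_add' := fun x y => by ext; simp }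
  have hf : Function.Surjective f := fun c => by
    obtain ⟨y, hy, h⟩ := hw c
    exact ⟨⟨y, hy⟩, funext h⟩
  have h1 := natCard_fiber_of_surjective f hf c
  rw [Nat.card_fun, Nat.card_fin] at h1
  rw [← h1]
  congr 1
  refine Nat.card_congr ((Equiv.subtypeSubtypeEquivSubtypeInter (· ∈ H) _).symm.trans
    (Equiv.subtypeEquivRight fun x => ?_))
  simp [f, funext_iff]

theorem card_orthIn {H : Submodule F V} {n : ℕ} {w : Fin n → V}
    (hw : ∀ c : Fin n → F, ∃ y ∈ H, ∀ j, B (w j) y = c j) :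
    (Nat.card (orthIn B H w) : ℚ) = Nat.card H / (Nat.card F : ℚ) ^ n := by
  have h := card_system hw 0
  have h2 : (Nat.card F : ℚ) ≠ 0 := Nat.cast_ne_zero.2 Nat.card_pos.ne'
  rw [eq_div_iff (pow_ne_zero _ h2), ← h]
  push_cast
  rfl

/-- The number of isotropic vectors in a subspace. -/
noncomputable def isotropicCount (B : LinearMap.BilinForm F V) (H : Submodule F V) : ℕ :=
  Nat.card {x // x ∈ H ∧ B x x = 0}

/-- If `B u x ≠ 0`, then `B (x + s u) (x + s u)` is a nonconstant affine function of `s`, so every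
line `x + F u` off the hyperplane orthogonal to `u` contains exactly one isotropic vector. Hence one
in `|F|` of the vectors off that hyperplane is isotropic. -/
theorem isotropicCount_step (h2 : (2 : F) ≠ 0) (hs : B.IsSymm) {H : Submodule F V} {u : V}
    (hu : u ∈ H) (huu : B u u = 0) (hh : ∃ h ∈ H, B u h ≠ 0) :
    (isotropicCount B H : ℚ) = Nat.card {x // x ∈ H ∧ B u x = 0 ∧ B x x = 0} +
      (Nat.card H / Nat.card F - Nat.card H / (Nat.card F : ℚ) ^ 2) := by
  have hq : (Nat.card F : ℚ) ≠ 0 := Nat.cast_ne_zero.2 Nat.card_pos.ne'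
  have e1 := natCard_subtype_split (fun x => x ∈ H ∧ B x x = 0) (fun x => B u x = 0)
  have e2 := natCard_subtype_split (fun x => x ∈ H) (fun x => B u x = 0)
  have e3 : Nat.card {x // x ∈ H ∧ B u x = 0} * Nat.card F = Nat.card H := by
    have := card_system (B := B) (H := H) (w := fun _ : Fin 1 => u) (fun c => by
      obtain ⟨h, hH, hne⟩ := hh
      refine ⟨(c 0 / B u h) • h, H.smul_mem _ hH, fun j => ?_⟩
      rw [Subsingleton.elim j 0]
      simp [hne]) 0
    simpa using this
  -- The pair attached to `x` is the isotropic point of its line together with the position of `x`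
  -- relative to that point.
  have e4 : Nat.card {x // x ∈ H ∧ ¬ B u x = 0} =
      Nat.card {x // (x ∈ H ∧ B x x = 0) ∧ ¬ B u x = 0} * Nat.card F := by
    rw [← Nat.card_prod]
    refine Nat.card_congr
      { toFun := fun x => (⟨x.1 - (B x.1 x.1 / (2 * B u x.1)) • u, ?_⟩, B x.1 x.1 / (2 * B u x.1))
        invFun := fun y => ⟨y.1.1 + y.2 • u, ?_⟩
        left_inv := fun x => ?_
        right_inv := fun y => ?_ }
    · obtain ⟨x, hx, hux⟩ := x
      refine ⟨⟨H.sub_mem hx (H.smul_mem _ hu), ?_⟩, ?_⟩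
      · simp only [map_sub, map_smul, LinearMap.sub_apply, LinearMap.smul_apply, smul_eq_mul, huu,
          hs.eq x u]
        field_simp
        ring
      · simpa [huu] using hux
    · obtain ⟨⟨y, ⟨hy, hyy⟩, huy⟩, s⟩ := y
      refine ⟨H.add_mem hy (H.smul_mem _ hu), ?_⟩
      simpa [huu] using huy
    · simp
    · obtain ⟨⟨y, ⟨hy, hyy⟩, huy⟩, s⟩ := y
      have h3 : B (y + s • u) (y + s • u) / (2 * B u (y + s • u)) = s := by
        simp only [map_add, map_smul, LinearMap.add_apply, LinearMap.smul_apply, smul_eq_mul, huu,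
          hs.eq y u, hyy]
        rw [div_eq_iff (mul_ne_zero h2 (by simpa using huy))]
        ring
      refine Prod.ext (Subtype.ext ?_) h3
      change y + s • u - (B (y + s • u) (y + s • u) / (2 * B u (y + s • u))) • u = y
      rw [h3, add_sub_cancel_right]
  have e5 : Nat.card {x // (x ∈ H ∧ B x x = 0) ∧ B u x = 0} =
      Nat.card {x // x ∈ H ∧ B u x = 0 ∧ B x x = 0} :=
    Nat.card_congr (Equiv.subtypeEquivRight fun x => by tauto)
  have e6 : Nat.card {x // x ∈ H} = Nat.card H := rfl
  rw [e6] at e2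
  rw [isotropicCount, e1, e5]
  push_cast
  congr 1
  have e2' : (Nat.card H : ℚ) = Nat.card {x // x ∈ H ∧ B u x = 0} +
    Nat.card {x // (x ∈ H ∧ B x x = 0) ∧ ¬ B u x = 0} * Nat.card F := by
    rw [e2, e4]; push_cast; rfl
  have e3' : (Nat.card {x // x ∈ H ∧ B u x = 0} : ℚ) = Nat.card H / Nat.card F := by
    rw [← e3]; push_cast; field_simp
  rw [e3'] at e2'
  field_simp at e2' ⊢
  linarith

/-- Imposing orthogonality to one isotropic vector at a time, the corrections of
`isotropicCount_step` telescope. -/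
theorem isotropicCount_orthIn (h2 : (2 : F) ≠ 0) (hs : B.IsSymm) {H : Submodule F V} {n : ℕ}
    (w : Fin n → V) (hwH : ∀ i, w i ∈ H) (hww : ∀ i j, B (w i) (w j) = 0)
    (hw : ∀ c : Fin n → F, ∃ y ∈ H, ∀ j, B (w j) y = c j) :
    (isotropicCount B (orthIn B H w) : ℚ) = isotropicCount B H - Nat.card H / Nat.card F +
      Nat.card H / (Nat.card F : ℚ) ^ (n + 1) := by
  have hq : (Nat.card F : ℚ) ≠ 0 := Nat.cast_ne_zero.2 Nat.card_pos.ne'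
  induction n with
  | zero =>
    have : orthIn B H w = H := by ext; simp [mem_orthIn]
    rw [this]; simp
  | succ n ih =>
    obtain ⟨u, w, rfl⟩ : ∃ u w', w = Fin.cons u w' := ⟨w 0, Fin.tail w, by simp⟩
    simp only [Fin.forall_fin_succ, Fin.cons_zero, Fin.cons_succ] at hwH hww hw
    have hw' : ∀ c : Fin n → F, ∃ y ∈ H, ∀ j, B (w j) y = c j := fun c => by
      obtain ⟨y, hy, h⟩ := hw (Fin.cons 0 c)
      exact ⟨y, hy, fun j => by simpa using h.2 j⟩
    have h1 := ih w hwH.2 (fun i j => (hww.2 i).2 j) hw'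
    have h3 := isotropicCount_step (B := B) (H := orthIn B H w) (u := u) h2 hs
      ⟨hwH.1, fun i => (hww.2 i).1⟩ hww.1.1 (by
        obtain ⟨y, hy, h⟩ := hw (Fin.cons 1 0)
        refine ⟨y, ⟨hy, fun j => by simpa using h.2 j⟩, ?_⟩
        have := h.1
        simp only [Fin.cons_zero] at this
        rw [this]; exact one_ne_zero)
    have h4 : Nat.card {x // x ∈ orthIn B H w ∧ B u x = 0 ∧ B x x = 0} =
        isotropicCount B (orthIn B H (Fin.cons u w : Fin (n + 1) → V)) :=
      Nat.card_congr (Equiv.subtypeEquivRight fun x => by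
        simp only [mem_orthIn, Fin.forall_fin_succ, Fin.cons_zero, Fin.cons_succ]; tauto)
    rw [h4, h1, card_orthIn hw', div_div, div_div, ← pow_succ, ← pow_add] at h3
    rw [show n + 1 + 1 = n + 2 from rfl]
    linarith

omit [Finite F] [Finite V] in
theorem card_span_of_linearIndependent {n : ℕ} {w : Fin n → V} (hw : LinearIndependent F w) :
    Nat.card (Submodule.span F (Set.range w)) = Nat.card F ^ n := by
  rw [Nat.card_congr (Basis.span hw).equivFun.toEquiv, Nat.card_fun, Nat.card_fin]

/-- The admissible `x` are the isotropic vectors orthogonal to `w` outside the span of `w`; the span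
is itself isotropic and orthogonal to `w`, so its `|F|^n` elements are simply subtracted. -/
theorem card_frame_extension (h2 : (2 : F) ≠ 0) (hs : B.IsSymm) {H : Submodule F V} {n : ℕ}
    {w : Fin n → V} (hwH : ∀ i, w i ∈ H) (hf : IsFrame B w)
    (hw : ∀ c : Fin n → F, ∃ y ∈ H, ∀ j, B (w j) y = c j) :
    (Nat.card {x // x ∈ H ∧ IsFrame B (Fin.cons x w : Fin (n + 1) → V)} : ℚ) =
      isotropicCount B H - Nat.card H / Nat.card F + Nat.card H / (Nat.card F : ℚ) ^ (n + 1) -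
        (Nat.card F : ℚ) ^ n := by
  rw [← isotropicCount_orthIn h2 hs w hwH hf.2 hw, eq_sub_iff_add_eq, isotropicCount,
    natCard_subtype_split (fun x => x ∈ orthIn B H w ∧ B x x = 0)
      (fun x => x ∈ Submodule.span F (Set.range w)), Nat.cast_add, add_comm]
  congr 1
  · rw [← Nat.cast_pow, ← card_span_of_linearIndependent hf.1]
    congr 1
    refine Nat.card_congr (Equiv.subtypeEquivRight fun x => ⟨fun hx => ⟨⟨⟨?_, ?_⟩, ?_⟩, hx⟩, And.right⟩)
    · exact Submodule.span_le.2 (Set.range_subset_iff.2 hwH) hx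
    · intro i
      induction hx using Submodule.span_induction with
      | mem x hx => obtain ⟨j, rfl⟩ := hx; exact hf.2 i j
      | zero => simp
      | add x y _ _ h1 h2 => simp [h1, h2]
      | smul a x _ h => simp [h]
    · have h3 : ∀ j, B x (w j) = 0 := by
        intro j
        induction hx using Submodule.span_induction with
        | mem x hx => obtain ⟨i, rfl⟩ := hx; exact hf.2 i j
        | zero => simp
        | add x y _ _ h1 h2 => simp [h1, h2]
        | smul a x _ h => simp [h]
      clear h2
      have : ∀ y ∈ Submodule.span F (Set.range w), B x y = 0 := by
        intro y hy
        induction hy using Submodule.span_induction with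
        | mem y hy => obtain ⟨i, rfl⟩ := hy; exact h3 i
        | zero => simp
        | add x y _ _ h1 h2 => simp [h1, h2]
        | smul a x _ h => simp [h]
      exact this x hx
  · congr 1
    refine Nat.card_congr (Equiv.subtypeEquivRight fun x => ?_)
    rw [isFrame_cons hs, mem_orthIn]
    tauto

/-- The solvability hypothesis `hH` stands in for nondegeneracy on `H`; it is later verified for the
whole space and for the hyperplane orthogonal to an anisotropic vector. -/
theorem card_frames (h2 : (2 : F) ≠ 0) (hs : B.IsSymm) (H : Submodule F V)
    (hH : ∀ (n : ℕ) (w : Fin n → V), (∀ i, w i ∈ H) → IsFrame B w →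
      ∀ c : Fin n → F, ∃ y ∈ H, ∀ j, B (w j) y = c j) (n : ℕ) :
    (Nat.card {w : Fin n → V // IsFrame B w ∧ ∀ i, w i ∈ H} : ℚ) =
      ∏ i ∈ Finset.range n, ((isotropicCount B H : ℚ) - Nat.card H / Nat.card F +
        Nat.card H / (Nat.card F : ℚ) ^ (i + 1) - (Nat.card F : ℚ) ^ i) := by
  induction n with
  | zero =>
    have : ∀ w : Fin 0 → V, IsFrame B w ∧ ∀ i, w i ∈ H := fun w =>
      ⟨⟨linearIndependent_empty_type, fun i => i.elim0⟩, fun i => i.elim0⟩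
    rw [Nat.card_congr (Equiv.subtypeUnivEquiv this)]
    simp
  | succ n ih =>
    rw [Finset.prod_range_succ, ← ih]
    refine natCard_cons ?_ _ fun w hw => ?_
    · simp only [isFrame_cons hs, Fin.forall_fin_succ, Fin.cons_succ]
      tauto
    · rw [← card_frame_extension h2 hs hw.2 hw.1 (hH n w hw.2 hw.1)]
      congr 1
      refine Nat.card_congr (Equiv.subtypeEquivRight fun x => ?_)
      simp only [Fin.forall_fin_succ, Fin.cons_succ, Fin.cons_zero]
      tauto

/-- The vector `K` sits at the end so that the induction can prepend vectors without moving it. It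
already counts as a frame member, hence the exponents shifted by one against `card_frames`. -/
theorem card_frames_snoc (h2 : (2 : F) ≠ 0) (hs : B.IsSymm) (hB : B.Nondegenerate) {K : V}
    (hK : K ≠ 0) (hKK : B K K = 0) (n : ℕ) :
    (Nat.card {w : Fin n → V // IsFrame B (Fin.snoc w K : Fin (n + 1) → V)} : ℚ) =
      ∏ i ∈ Finset.range n, ((isotropicCount B ⊤ : ℚ) - Nat.card V / Nat.card F +
        Nat.card V / (Nat.card F : ℚ) ^ (i + 2) - (Nat.card F : ℚ) ^ (i + 1)) := by
  induction n with
  | zero =>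
    have : ∀ w : Fin 0 → V, IsFrame B (Fin.snoc w K : Fin 1 → V) := fun w =>
      ⟨LinearIndependent.of_subsingleton (ι := Fin 1) 0 (by simpa [Fin.snoc] using hK),
        fun i j => by simpa [Fin.snoc] using hKK⟩
    rw [Nat.card_congr (Equiv.subtypeUnivEquiv this)]
    simp
  | succ n ih =>
    rw [Finset.prod_range_succ, ← ih]
    refine natCard_cons (fun x w h => ?_) _ fun w hw => ?_
    · rw [← Fin.cons_snoc_eq_snoc_cons, isFrame_cons hs] at h
      exact h.1
    · have := card_frame_extension (H := ⊤) h2 hs (fun _ => Submodule.mem_top) hw (fun c => by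
        obtain ⟨y, hy⟩ := exists_apply_eq hB hs hw.1 c
        exact ⟨y, Submodule.mem_top, hy⟩)
      rw [show Nat.card (⊤ : Submodule F V) = Nat.card V from
        Nat.card_congr Submodule.topEquiv.toEquiv] at this
      rw [← this]
      congr 1
      refine Nat.card_congr (Equiv.subtypeEquivRight fun x => ?_)
      rw [← Fin.cons_snoc_eq_snoc_cons]
      simp

omit [Finite F] in
theorem card_sub_span {W : Submodule F V} {n : ℕ} {w : Fin n → V} (hw : LinearIndependent F w)
    (hwW : ∀ i, w i ∈ W) :
    (Nat.card {x // x ∈ W ∧ x ∉ Submodule.span F (Set.range w)} : ℚ) =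
      Nat.card W - (Nat.card F : ℚ) ^ n := by
  have h1 := natCard_subtype_split (fun x => x ∈ W) (fun x => x ∈ Submodule.span F (Set.range w))
  have h2 : Nat.card {x // x ∈ W ∧ x ∈ Submodule.span F (Set.range w)} = Nat.card F ^ n := by
    rw [← card_span_of_linearIndependent hw]
    exact Nat.card_congr (Equiv.subtypeEquivRight fun x =>
      ⟨And.right, fun h => ⟨Submodule.span_le.2 (Set.range_subset_iff.2 hwW) h, h⟩⟩)
  have h3 : Nat.card {x // x ∈ W} = Nat.card W := rfl
  rw [← h3, h1, h2]
  push_cast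
  ring

omit [Finite F] in
theorem card_linearIndependent_in (W : Submodule F V) (n : ℕ) :
    (Nat.card {w : Fin n → V // LinearIndependent F w ∧ ∀ i, w i ∈ W} : ℚ) =
      ∏ i ∈ Finset.range n, ((Nat.card W : ℚ) - (Nat.card F : ℚ) ^ i) := by
  induction n with
  | zero =>
    have : ∀ w : Fin 0 → V, LinearIndependent F w ∧ ∀ i, w i ∈ W := fun w =>
      ⟨linearIndependent_empty_type, fun i => i.elim0⟩
    rw [Nat.card_congr (Equiv.subtypeUnivEquiv this)]
    simp
  | succ n ih =>
    rw [Finset.prod_range_succ, ← ih]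
    refine natCard_cons ?_ _ fun w hw => ?_
    · simp only [linearIndependent_finCons, Fin.forall_fin_succ, Fin.cons_succ]
      tauto
    · rw [← card_sub_span hw.1 hw.2]
      congr 1
      refine Nat.card_congr (Equiv.subtypeEquivRight fun x => ?_)
      simp only [linearIndependent_finCons, Fin.forall_fin_succ, Fin.cons_succ, Fin.cons_zero]
      tauto

omit [Finite F] in
theorem card_linearIndependent_snoc_in (W : Submodule F V) {K : V} (hK : K ≠ 0) (hKW : K ∈ W)
    (n : ℕ) :
    (Nat.card {w : Fin n → V // LinearIndependent F (Fin.snoc w K : Fin (n + 1) → V) ∧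
        ∀ i, w i ∈ W} : ℚ) =
      ∏ i ∈ Finset.range n, ((Nat.card W : ℚ) - (Nat.card F : ℚ) ^ (i + 1)) := by
  induction n with
  | zero =>
    have : ∀ w : Fin 0 → V, LinearIndependent F (Fin.snoc w K : Fin 1 → V) ∧ ∀ i, w i ∈ W :=
      fun w => ⟨LinearIndependent.of_subsingleton (ι := Fin 1) 0 (by simpa [Fin.snoc] using hK), fun i => i.elim0⟩
    rw [Nat.card_congr (Equiv.subtypeUnivEquiv this)]
    simp
  | succ n ih =>
    rw [Finset.prod_range_succ, ← ih]
    refine natCard_cons (fun x w h => ?_) _ fun w hw => ?_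
    · rw [← Fin.cons_snoc_eq_snoc_cons, linearIndependent_finCons] at h
      exact ⟨h.1.1, fun i => by simpa using h.2 i.succ⟩
    · rw [← card_sub_span hw.1 (W := W)]
      · congr 1
        refine Nat.card_congr (Equiv.subtypeEquivRight fun x => ?_)
        rw [← Fin.cons_snoc_eq_snoc_cons, linearIndependent_finCons]
        simp only [Fin.forall_fin_succ, Fin.cons_succ, Fin.cons_zero]
        tauto
      · intro i
        refine Fin.lastCases ?_ (fun i => ?_) i
        · simpa using hKW
        · simpa using hw.2 i

end Frames

/-! ### Isotropic vectors in a nondegenerate space and in an anisotropic hyperplane section. -/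

section IsotropicCount

open Module

variable {F V : Type*} [Field F] [Fintype F] [DecidableEq F] [AddCommGroup V] [Module F V]
  [Finite V] {B : LinearMap.BilinForm F V}

omit [Fintype F] [DecidableEq F] [Finite V] in
theorem isotropicCount_eq_diagonal {H : Submodule F V} {n : ℕ} (e : Basis (Fin n) F H)
    (he : ∀ i j, i ≠ j → B (e i) (e j) = 0) :
    isotropicCount B H =
      Nat.card {x : Fin n → F // ∑ i, B (e i) (e i) * x i ^ 2 = 0} := by
  refine Nat.card_congr ((Equiv.subtypeSubtypeEquivSubtypeInter (· ∈ H) _).symm.trans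
    (e.equivFun.toEquiv.subtypeEquiv fun x => ?_))
  have h1 : (x : V) = ∑ i, e.equivFun x i • (e i : V) := by
    conv_lhs => rw [← e.sum_equivFun x]
    rw [Submodule.coe_sum]
    rfl
  have h2 : B x x = ∑ i, B (e i) (e i) * e.equivFun x i ^ 2 := by
    conv_lhs => rw [h1]
    simp only [map_sum, LinearMap.sum_apply, map_smul, LinearMap.smul_apply, smul_eq_mul]
    refine Finset.sum_congr rfl fun i _ => ?_
    rw [Finset.sum_eq_single i]
    · ring
    · intro j _ hj
      rw [he j i hj]; simp
    · simp
  rw [h2]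
  rfl

omit [DecidableEq F] in
theorem isotropicCount_top_odd (hF : ringChar F ≠ 2) (hs : B.IsSymm) (hB : B.Nondegenerate)
    {k : ℕ} (hV : finrank F V = 2 * k + 1) :
    isotropicCount B ⊤ = Fintype.card F ^ (2 * k) := by
  classical
  have : Invertible (2 : F) := invertibleOfNonzero (Ring.two_ne_zero hF)
  obtain ⟨e, he⟩ := LinearMap.BilinForm.exists_orthogonal_basis (B := B)
    ⟨fun x y => hs.eq x y⟩
  have hne := LinearMap.BilinForm.iIsOrtho.not_isOrtho_basis_self_of_nondegenerate he hB
  revert e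
  rw [hV]
  intro e he hne
  rw [isotropicCount_eq_diagonal (e.map Submodule.topEquiv.symm)]
  · exact card_diagonal_zeros_odd hF _ (by simpa using hne)
  · intro i j hij
    simpa using he hij

/-- An orthogonal basis of the hyperplane together with `K` diagonalizes `B` on `V`. Comparing Gram
determinants modulo squares, the discriminant of the hyperplane is `B K K` times that of `V`. -/
theorem isotropicCount_hyperplane (hF : ringChar F ≠ 2) (hs : B.IsSymm)
    {k : ℕ} (hk : 1 ≤ k) (b : Basis (Fin (2 * k + 1)) F V)
    (hb : (LinearMap.BilinForm.toMatrix b B).det ≠ 0) {K : V} (hK : B K K ≠ 0) :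
    (isotropicCount B (LinearMap.ker (B K)) : ℤ) = (Fintype.card F : ℤ) ^ (2 * k - 1) +
      quadraticChar F (B K K) *
        quadraticChar F ((-1) ^ k * (LinearMap.BilinForm.toMatrix b B).det) *
        ((Fintype.card F : ℤ) ^ k - (Fintype.card F : ℤ) ^ (k - 1)) := by
  have : Invertible (2 : F) := invertibleOfNonzero (Ring.two_ne_zero hF)
  set H := LinearMap.ker (B K) with hH
  have hr : finrank F H = 2 * k := by
    have h1 := Module.Dual.finrank_ker_add_one_of_ne_zero (f := B K)
      (fun h => hK (by rw [h]; rfl))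
    rw [finrank_eq_card_basis b, Fintype.card_fin, ← hH] at h1
    omega
  obtain ⟨e, he⟩ := LinearMap.BilinForm.exists_orthogonal_basis (B := B.restrict H)
    ⟨fun x y => hs.eq x y⟩
  revert e
  rw [hr]
  intro e he
  have heB : ∀ i j, i ≠ j → B (e i) (e j) = 0 := fun i j hij => he hij
  have hKe : ∀ i, B K (e i) = 0 := fun i => LinearMap.mem_ker.1 (e i).2
  let c : Basis (Fin (2 * k + 1)) F V := Basis.mkFinCons K e
    (fun a x hx h => by
      have h3 := congrArg (B K) h
      rw [map_add, map_smul, LinearMap.mem_ker.1 hx] at h3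
      simpa [hK] using h3)
    (fun z => ⟨-(B K z / B K K), by
      rw [hH, LinearMap.mem_ker]
      simp [hK]⟩)
  have hc : ⇑c = Fin.cons K (fun i => (e i : V)) := Basis.coe_mkFinCons _ _ _ _
  have hdiag : LinearMap.BilinForm.toMatrix c B =
      Matrix.diagonal (Fin.cons (B K K) fun i => B (e i) (e i)) := by
    ext i j
    rw [LinearMap.BilinForm.toMatrix_apply, hc]
    refine Fin.cases ?_ (fun i => ?_) i <;> refine Fin.cases ?_ (fun j => ?_) j
    · simp
    · simp [hKe, (Fin.succ_ne_zero j).symm]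
    · simp [hs.eq _ K, hKe, Fin.succ_ne_zero i]
    · rcases eq_or_ne i j with rfl | hij
      · simp
      · simp [heB i j hij, hij]
  have hdet := congrArg Matrix.det (LinearMap.BilinForm.toMatrix_mul_basis_toMatrix b c B)
  rw [hdiag, Matrix.det_mul, Matrix.det_mul, Matrix.det_transpose, Matrix.det_diagonal,
    Fin.prod_univ_succ] at hdet
  simp only [Fin.cons_zero, Fin.cons_succ] at hdet
  have hP : (b.toMatrix c).det ≠ 0 := by
    intro h
    have h1 := congrArg Matrix.det (b.toMatrix_mul_toMatrix_flip c)
    rw [Matrix.det_mul, h, zero_mul, Matrix.det_one] at h1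
    exact zero_ne_one h1
  -- A vanishing diagonal entry would make the whole Gram determinant vanish.
  have hne : ∀ i, B (e i) (e i) ≠ 0 := by
    intro i hi
    rw [Finset.prod_eq_zero (Finset.mem_univ i) hi, mul_zero] at hdet
    exact mul_ne_zero (mul_ne_zero hP hb) hP hdet
  rw [isotropicCount_eq_diagonal e heB, card_diagonal_zeros_even hF hk _ hne]
  have h4 := congrArg (quadraticChar F) hdet
  simp only [map_mul] at h4
  have h5 := quadraticChar_sq_one hP
  have h6 := quadraticChar_sq_one hK
  rw [map_mul, map_mul]
  linear_combination
    (((Fintype.card F : ℤ) ^ k - (Fintype.card F : ℤ) ^ (k - 1)) *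
      quadraticChar F ((-1) ^ k)) * (-quadraticChar F (∏ i, B (e i) (e i)) * h6
      - quadraticChar F (B K K) * h4 + quadraticChar F (B K K) *
        quadraticChar F ((LinearMap.BilinForm.toMatrix b B).det) * h5)

end IsotropicCount

/-! ### Lifting frames from `ℤ/p` to `ℤ/p²`. -/

section Lifts

variable {p : ℕ} [Fact p.Prime] {m : ℕ}

/-- The bilinear form over `R` defined by an integral matrix. -/
noncomputable def modForm (R : Type*) [CommRing R] (Q : Matrix (Fin m) (Fin m) ℤ) :
    LinearMap.BilinForm R (Fin m → R) :=
  Matrix.toBilin' (Q.map (Int.cast : ℤ → R))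

theorem modForm_apply {R : Type*} [CommRing R] (Q : Matrix (Fin m) (Fin m) ℤ) (x y : Fin m → R) :
    modForm R Q x y = ∑ i, ∑ j, x i * (Q i j : R) * y j := by
  simp [modForm, Matrix.toBilin'_apply]

theorem modForm_isSymm {R : Type*} [CommRing R] {Q : Matrix (Fin m) (Fin m) ℤ} (hQ : Q.IsSymm) :
    (modForm R Q).IsSymm := by
  refine ⟨fun x y => ?_⟩
  rw [modForm_apply, modForm_apply, Finset.sum_comm]
  refine Finset.sum_congr rfl fun i _ => Finset.sum_congr rfl fun j _ => ?_
  rw [hQ.apply]; ring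

/-- Reduction from `ZMod (p ^ 2)` to `ZMod p`. -/
def redHom (p : ℕ) : ZMod (p ^ 2) →+* ZMod p :=
  ZMod.castHom (dvd_pow_self p two_ne_zero) (ZMod p)

/-- Multiplication by `p` as a map from `ZMod p` to `ZMod (p ^ 2)`. -/
def mulHom (p : ℕ) : ZMod p →+ ZMod (p ^ 2) :=
  ZMod.lift p ⟨(AddMonoidHom.mulLeft (p : ZMod (p ^ 2))).comp (Int.castAddHom _), by
    have : ((p : ZMod (p ^ 2)) * (p : ZMod (p ^ 2))) = 0 := by
      rw [← sq, ← Nat.cast_pow, ZMod.natCast_self]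
    simpa using this⟩

theorem mulHom_intCast (a : ℤ) : mulHom p (a : ZMod p) = (p : ZMod (p ^ 2)) * a := by
  simp [mulHom]

theorem mulHom_mul (a : ZMod p) (c : ZMod (p ^ 2)) : mulHom p a * c = mulHom p (a * redHom p c) := by
  obtain ⟨a, rfl⟩ := ZMod.intCast_surjective a
  obtain ⟨c, rfl⟩ := ZMod.intCast_surjective c
  rw [map_intCast (redHom p), ← Int.cast_mul, mulHom_intCast, mulHom_intCast]
  push_cast; ring

theorem mulHom_injective : Function.Injective (mulHom p) := by
  rw [injective_iff_map_eq_zero]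
  intro a ha
  obtain ⟨a, rfl⟩ := ZMod.intCast_surjective a
  rw [mulHom_intCast, ← Int.cast_natCast p, ← Int.cast_mul, ZMod.intCast_zmod_eq_zero_iff_dvd] at ha
  rw [ZMod.intCast_zmod_eq_zero_iff_dvd]
  push_cast at ha
  rw [sq] at ha
  exact Int.dvd_of_mul_dvd_mul_left (by exact_mod_cast (Fact.out : p.Prime).ne_zero) ha

theorem redHom_mulHom (a : ZMod p) : redHom p (mulHom p a) = 0 := by
  obtain ⟨a, rfl⟩ := ZMod.intCast_surjective a
  rw [mulHom_intCast]; simp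

theorem exists_mulHom_eq {a : ZMod (p ^ 2)} (ha : redHom p a = 0) : ∃ b, mulHom p b = a := by
  obtain ⟨a, rfl⟩ := ZMod.intCast_surjective a
  rw [map_intCast, ZMod.intCast_zmod_eq_zero_iff_dvd] at ha
  obtain ⟨b, rfl⟩ := ha
  exact ⟨b, by rw [mulHom_intCast]; push_cast; rfl⟩

/-- Coordinatewise reduction modulo `p`. -/
def red (p m : ℕ) : (Fin m → ZMod (p ^ 2)) →+ (Fin m → ZMod p) :=
  (redHom p).toAddMonoidHom.compLeft (Fin m)

/-- Coordinatewise multiplication by `p`. -/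
def inj (p m : ℕ) : (Fin m → ZMod p) →+ (Fin m → ZMod (p ^ 2)) :=
  (mulHom p).compLeft (Fin m)

omit [Fact p.Prime] in
theorem red_apply (x : Fin m → ZMod (p ^ 2)) (i : Fin m) : red p m x i = redHom p (x i) := rfl

omit [Fact p.Prime] in
theorem inj_apply (x : Fin m → ZMod p) (i : Fin m) : inj p m x i = mulHom p (x i) := rfl

omit [Fact p.Prime] in
theorem red_surjective : Function.Surjective (red p m) := fun y =>
  ⟨fun i => (ZMod.castHom_surjective (dvd_pow_self p two_ne_zero) (y i)).choose,
    funext fun i => (ZMod.castHom_surjective (dvd_pow_self p two_ne_zero) (y i)).choose_spec⟩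

theorem red_inj (y : Fin m → ZMod p) : red p m (inj p m y) = 0 :=
  funext fun i => redHom_mulHom (y i)

theorem exists_inj_eq {x : Fin m → ZMod (p ^ 2)} (hx : red p m x = 0) : ∃ y, inj p m y = x :=
  ⟨fun i => (exists_mulHom_eq (congrFun hx i)).choose,
    funext fun i => (exists_mulHom_eq (congrFun hx i)).choose_spec⟩

theorem inj_injective : Function.Injective (inj p m) := fun _ _ h =>
  funext fun i => mulHom_injective (congrFun h i)

theorem red_intCast_smul (a : ℤ) (x : Fin m → ZMod (p ^ 2)) :
    red p m ((a : ZMod (p ^ 2)) • x) = (a : ZMod p) • red p m x := by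
  ext i
  simp [red_apply]

variable {Q : Matrix (Fin m) (Fin m) ℤ}

omit [Fact p.Prime] in
theorem redHom_modForm (x y : Fin m → ZMod (p ^ 2)) :
    redHom p (modForm _ Q x y) = modForm _ Q (red p m x) (red p m y) := by
  simp [modForm_apply, red_apply]

/-- Pairing with a multiple of `p` only sees the other argument modulo `p`; this is what linearizes
the lifting problem. -/
theorem modForm_inj (y : Fin m → ZMod p) (x : Fin m → ZMod (p ^ 2)) :
    modForm _ Q (inj p m y) x = mulHom p (modForm _ Q y (red p m x)) := by
  simp only [modForm_apply, map_sum, inj_apply, red_apply, mul_assoc, mulHom_mul,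
    map_intCast]

/-- A tuple of vectors modulo `p ^ 2` with vanishing Gram matrix, linearly independent
modulo `p`. -/
def IsLiftFrame (Q : Matrix (Fin m) (Fin m) ℤ) {n : ℕ} (v : Fin n → Fin m → ZMod (p ^ 2)) : Prop :=
  LinearIndependent (ZMod p) (red p m ∘ v) ∧ ∀ i j, modForm _ Q (v i) (v j) = 0

omit [Fact p.Prime] in
theorem red_comp_cons {n : ℕ} (x : Fin m → ZMod (p ^ 2)) (v : Fin n → Fin m → ZMod (p ^ 2)) :
    red p m ∘ (Fin.cons x v : Fin (n + 1) → Fin m → ZMod (p ^ 2)) =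
      Fin.cons (red p m x) (red p m ∘ v) := by
  ext i : 1
  refine Fin.cases ?_ (fun i => ?_) i <;> simp

omit [Fact p.Prime] in
theorem red_comp_snoc {n : ℕ} (x : Fin m → ZMod (p ^ 2)) (v : Fin n → Fin m → ZMod (p ^ 2)) :
    red p m ∘ (Fin.snoc v x : Fin (n + 1) → Fin m → ZMod (p ^ 2)) =
      Fin.snoc (red p m ∘ v) (red p m x) := by
  ext i : 1
  refine Fin.lastCases ?_ (fun i => ?_) i <;> simp

theorem IsLiftFrame.isFrame {n : ℕ} {v : Fin n → Fin m → ZMod (p ^ 2)} (hv : IsLiftFrame Q v) :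
    IsFrame (modForm (ZMod p) Q) (red p m ∘ v) :=
  ⟨hv.1, fun i j => by
    rw [Function.comp_apply, Function.comp_apply, ← redHom_modForm, hv.2, map_zero]⟩

theorem isLiftFrame_cons (hQ : Q.IsSymm) {n : ℕ} (x : Fin m → ZMod (p ^ 2))
    (v : Fin n → Fin m → ZMod (p ^ 2)) :
    IsLiftFrame Q (Fin.cons x v : Fin (n + 1) → Fin m → ZMod (p ^ 2)) ↔
      IsLiftFrame Q v ∧ (∀ j, modForm _ Q (v j) x = 0) ∧ modForm _ Q x x = 0 ∧
        red p m x ∉ Submodule.span (ZMod p) (Set.range (red p m ∘ v)) := by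
  simp only [IsLiftFrame, red_comp_cons, linearIndependent_finCons, Fin.forall_fin_succ,
    Fin.cons_zero, Fin.cons_succ]
  constructor
  · rintro ⟨⟨h1, h2⟩, ⟨h3, h4⟩, h5⟩
    exact ⟨⟨h1, fun i => (h5 i).2⟩, fun i => (h5 i).1, h3, h2⟩
  · rintro ⟨⟨h1, h2⟩, h3, h4, h5⟩
    exact ⟨⟨h1, h5⟩, ⟨h4, fun i => by rw [(modForm_isSymm hQ).eq]; exact h3 i⟩,
      fun i => ⟨h3 i, h2 i⟩⟩

theorem two_ne_zero_zmod (hp2 : p ≠ 2) : (2 : ZMod p) ≠ 0 := by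
  have : ringChar (ZMod p) ≠ 2 := by rwa [ZMod.ringChar_zmod_n]
  exact Ring.two_ne_zero this

theorem isUnit_two_zmod_sq (hp2 : p ≠ 2) : IsUnit (2 : ZMod (p ^ 2)) := by
  have h : Nat.Coprime 2 (p ^ 2) :=
    Nat.Coprime.pow_right 2 ((Nat.coprime_primes Nat.prime_two Fact.out).2 hp2.symm)
  exact_mod_cast (ZMod.unitOfCoprime 2 h).isUnit

/-- All lifts are `x₀ + p y`, and the term quadratic in `p y` vanishes modulo `p²`. What remains are
`n + 1` linear equations for `y` modulo `p`, independent because the reduced frame is. -/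
theorem card_lift_extension (hp2 : p ≠ 2) (hQ : Q.IsSymm) (hB : (modForm (ZMod p) Q).Nondegenerate)
    {n : ℕ} {v : Fin n → Fin m → ZMod (p ^ 2)} (hv : IsLiftFrame Q v) {w : Fin m → ZMod p}
    (hw : IsFrame (modForm _ Q) (Fin.cons w (red p m ∘ v) : Fin (n + 1) → Fin m → ZMod p)) :
    (Nat.card {x // IsLiftFrame Q (Fin.cons x v : Fin (n + 1) → Fin m → ZMod (p ^ 2)) ∧
      red p m x = w} : ℚ) = (p : ℚ) ^ m / (p : ℚ) ^ (n + 1) := by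
  have hsV := modForm_isSymm (R := ZMod p) hQ
  have hsE := modForm_isSymm (R := ZMod (p ^ 2)) hQ
  obtain ⟨x₀, rfl⟩ := red_surjective w
  have h1 := (isFrame_cons hsV _ _).1 hw
  obtain ⟨a, ha⟩ := exists_mulHom_eq (a := modForm _ Q x₀ x₀) (by
    rw [redHom_modForm]; exact h1.2.2.1)
  have hc : ∀ j, ∃ b, mulHom p b = modForm _ Q (v j) x₀ := fun j => exists_mulHom_eq (by
    rw [redHom_modForm]; exact h1.2.1 j)
  choose b hb using hc
  -- With `B(x₀, x₀) = p a` and `B(v_j, x₀) = p b_j`, the conditions on `y` read `a + 2 B(x₀, y) =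
  -- 0` and `b_j + B(v_j, y) = 0` modulo `p`.
  let c : Fin (n + 1) → ZMod p := Fin.cons (-a / 2) fun j => -b j
  have h2 := card_system (B := modForm (ZMod p) Q) (H := ⊤) (fun c => by
    obtain ⟨y, hy⟩ := exists_apply_eq hB hsV hw.1 c
    exact ⟨y, Submodule.mem_top, hy⟩) c
  have h3 : Nat.card (⊤ : Submodule (ZMod p) (Fin m → ZMod p)) = p ^ m := by
    rw [Nat.card_congr Submodule.topEquiv.toEquiv, Nat.card_fun, Nat.card_zmod, Nat.card_fin]
  rw [h3, Nat.card_zmod] at h2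
  have hp0 : (p : ℚ) ≠ 0 := by exact_mod_cast (Fact.out : p.Prime).ne_zero
  rw [eq_div_iff (pow_ne_zero _ hp0)]
  have hr : ∀ y, red p m (x₀ + inj p m y) = red p m x₀ := fun y => by
    rw [map_add, red_inj, add_zero]
  have h0 : ∀ z, mulHom p z = 0 ↔ z = 0 := fun z => map_eq_zero_iff _ mulHom_injective
  have hiff : ∀ y, IsLiftFrame Q (Fin.cons (x₀ + inj p m y) v : Fin (n + 1) → _) ↔
      ∀ j, modForm (ZMod p) Q ((Fin.cons (red p m x₀) (red p m ∘ v) :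
          Fin (n + 1) → Fin m → ZMod p) j) y = c j := by
    intro y
    have h5 : modForm _ Q (x₀ + inj p m y) (x₀ + inj p m y) =
        mulHom p (a + 2 * modForm _ Q (red p m x₀) y) := by
      rw [LinearMap.BilinForm.add_left, map_add, map_add, hsE.eq x₀ (inj p m y), modForm_inj,
        modForm_inj, red_inj, map_zero, map_zero, ← ha, hsV.eq y, add_zero, two_mul, map_add,
        map_add, add_assoc]
    have h6 : ∀ j, modForm _ Q (v j) (x₀ + inj p m y) =
        mulHom p (b j + modForm _ Q (red p m (v j)) y) := fun j => by
      rw [map_add, hsE.eq _ (inj p m y), modForm_inj, ← hb, hsV.eq y, map_add]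
    rw [isLiftFrame_cons hQ, hr, h5]
    simp only [h6, h0, Fin.forall_fin_succ, Fin.cons_zero, Fin.cons_succ, c, Function.comp_apply]
    have h7 : ∀ z : ZMod p, a + 2 * z = 0 ↔ z = -a / 2 := fun z => by
      rw [eq_div_iff (two_ne_zero_zmod hp2), eq_neg_iff_add_eq_zero, mul_comm, add_comm]
    have h8 : ∀ j (z : ZMod p), b j + z = 0 ↔ z = -b j := fun j z => by
      rw [eq_neg_iff_add_eq_zero, add_comm]
    simp only [h7, h8]
    have := h1.2.2.2
    tauto
  have h4 : Nat.card {x // IsLiftFrame Q (Fin.cons x v : Fin (n + 1) → Fin m → ZMod (p ^ 2)) ∧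
      red p m x = red p m x₀} = Nat.card {y // y ∈ (⊤ : Submodule (ZMod p) (Fin m → ZMod p)) ∧
        ∀ j, modForm (ZMod p) Q ((Fin.cons (red p m x₀) (red p m ∘ v) :
          Fin (n + 1) → Fin m → ZMod p) j) y = c j} := by
    symm
    refine Nat.card_congr (Equiv.ofBijective
      (fun y => ⟨x₀ + inj p m y.1, (hiff _).2 y.2.2, hr _⟩) ⟨fun y z h => ?_, fun x => ?_⟩)
    · exact Subtype.ext (inj_injective (add_left_cancel (congrArg Subtype.val h)))
    · obtain ⟨x, hx, hxr⟩ := x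
      obtain ⟨y, hy⟩ := exists_inj_eq (x := x - x₀) (by rw [map_sub, hxr, sub_self])
      obtain rfl : x = x₀ + inj p m y := by rw [hy]; abel
      exact ⟨⟨y, Submodule.mem_top, (hiff y).1 hx⟩, rfl⟩
  rw [h4]
  exact_mod_cast h2

theorem card_lifts (hp2 : p ≠ 2) (hQ : Q.IsSymm) (hB : (modForm (ZMod p) Q).Nondegenerate)
    {n : ℕ} {w : Fin n → Fin m → ZMod p} (hw : IsFrame (modForm _ Q) w) :
    (Nat.card {v : Fin n → Fin m → ZMod (p ^ 2) // IsLiftFrame Q v ∧ red p m ∘ v = w} : ℚ) =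
      ∏ i ∈ Finset.range n, (p : ℚ) ^ m / (p : ℚ) ^ (i + 1) := by
  induction n with
  | zero =>
    have : ∀ v : Fin 0 → Fin m → ZMod (p ^ 2), IsLiftFrame Q v ∧ red p m ∘ v = w := fun v =>
      ⟨⟨linearIndependent_empty_type, fun i => i.elim0⟩, Subsingleton.elim _ _⟩
    rw [Nat.card_congr (Equiv.subtypeUnivEquiv this)]
    simp
  | succ n ih =>
    obtain ⟨u, w, rfl⟩ : ∃ u w', w = Fin.cons u w' := ⟨w 0, Fin.tail w, by simp⟩
    rw [Finset.prod_range_succ, ← ih ((isFrame_cons (modForm_isSymm hQ) _ _).1 hw).1]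
    refine natCard_cons (fun x v h => ?_) _ fun v hv => ?_
    · rw [isLiftFrame_cons hQ, red_comp_cons, Fin.cons_inj] at h
      exact ⟨h.1.1, h.2.2⟩
    · obtain ⟨hv, rfl⟩ := hv
      rw [← card_lift_extension hp2 hQ hB hv hw]
      congr 1
      refine Nat.card_congr (Equiv.subtypeEquivRight fun x => ?_)
      rw [red_comp_cons, Fin.cons_inj]
      tauto

/-- The lift `K` is prescribed, so it contributes no factor of its own but one more equation for
every other vector. -/
theorem card_lifts_snoc (hp2 : p ≠ 2) (hQ : Q.IsSymm) (hB : (modForm (ZMod p) Q).Nondegenerate)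
    {K : Fin m → ZMod (p ^ 2)} (hK : modForm _ Q K K = 0)
    {n : ℕ} {w : Fin n → Fin m → ZMod p}
    (hw : IsFrame (modForm _ Q) (Fin.snoc w (red p m K) : Fin (n + 1) → _)) :
    (Nat.card {v : Fin n → Fin m → ZMod (p ^ 2) //
        IsLiftFrame Q (Fin.snoc v K : Fin (n + 1) → _) ∧ red p m ∘ v = w} : ℚ) =
      ∏ i ∈ Finset.range n, (p : ℚ) ^ m / (p : ℚ) ^ (i + 2) := by
  induction n with
  | zero =>
    have : ∀ v : Fin 0 → Fin m → ZMod (p ^ 2),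
        IsLiftFrame Q (Fin.snoc v K : Fin 1 → _) ∧ red p m ∘ v = w := fun v => by
      obtain rfl := Subsingleton.elim (red p m ∘ v) w
      refine ⟨⟨?_, fun i j => by simpa [Fin.snoc] using hK⟩, rfl⟩
      rw [red_comp_snoc]
      exact hw.1
    rw [Nat.card_congr (Equiv.subtypeUnivEquiv this)]
    simp
  | succ n ih =>
    obtain ⟨u, w, rfl⟩ : ∃ u w', w = Fin.cons u w' := ⟨w 0, Fin.tail w, by simp⟩
    rw [← Fin.cons_snoc_eq_snoc_cons] at hw
    rw [Finset.prod_range_succ, ← ih ((isFrame_cons (modForm_isSymm hQ) _ _).1 hw).1]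
    refine natCard_cons (fun x v h => ?_) _ fun v hv => ?_
    · rw [← Fin.cons_snoc_eq_snoc_cons, isLiftFrame_cons hQ, red_comp_cons, Fin.cons_inj] at h
      exact ⟨h.1.1, h.2.2⟩
    · obtain ⟨hv, rfl⟩ := hv
      rw [← red_comp_snoc] at hw
      rw [← card_lift_extension hp2 hQ hB hv hw]
      congr 1
      refine Nat.card_congr (Equiv.subtypeEquivRight fun x => ?_)
      rw [← Fin.cons_snoc_eq_snoc_cons, red_comp_cons, Fin.cons_inj]
      tauto

theorem natCard_subtype_fiber {X Y : Type*} [Finite X] [Finite Y] (f : X → Y) {P : X → Prop}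
    {R : Y → Prop} (h : ∀ x, P x → R (f x)) (c : ℚ)
    (hc : ∀ y, R y → (Nat.card {x // P x ∧ f x = y} : ℚ) = c) :
    (Nat.card {x // P x} : ℚ) = Nat.card {y // R y} * c := by
  refine natCard_eq_mul_of_fiber (fun x : {x // P x} => (⟨f x, h x x.2⟩ : {y // R y})) c
    fun y => ?_
  rw [← hc y.1 y.2]
  congr 1
  refine Nat.card_congr (Equiv.trans (Equiv.subtypeEquivRight fun x => ?_)
    (Equiv.subtypeSubtypeEquivSubtypeInter P fun x => f x = y))
  exact Subtype.ext_iff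

theorem natCard_last_eq {X : Type*} {n : ℕ} (P : (Fin (n + 1) → X) → Prop) (K : X) :
    Nat.card {v // P v ∧ v (Fin.last n) = K} =
      Nat.card {v : Fin n → X // P (Fin.snoc v K : Fin (n + 1) → X)} := by
  symm
  refine Nat.card_congr (Equiv.ofBijective (fun v => ⟨Fin.snoc v.1 K, v.2, by simp⟩)
    ⟨fun v w h => ?_, fun v => ?_⟩)
  · exact Subtype.ext (Fin.snoc_injective2 (α := fun _ => X) (congrArg Subtype.val h)).1
  · obtain ⟨v, hv, rfl⟩ := v
    exact ⟨⟨Fin.init v, by rwa [Fin.snoc_init_self]⟩, Subtype.ext (Fin.snoc_init_self v)⟩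

theorem card_liftFrames (hp2 : p ≠ 2) (hQ : Q.IsSymm) (hB : (modForm (ZMod p) Q).Nondegenerate)
    {n : ℕ} (R : (Fin n → Fin m → ZMod p) → Prop) :
    (Nat.card {v : Fin n → Fin m → ZMod (p ^ 2) // IsLiftFrame Q v ∧ R (red p m ∘ v)} : ℚ) =
      Nat.card {w // IsFrame (modForm _ Q) w ∧ R w} *
        ∏ i ∈ Finset.range n, (p : ℚ) ^ m / (p : ℚ) ^ (i + 1) := by
  refine natCard_subtype_fiber (red p m ∘ ·) (fun v hv => ⟨hv.1.isFrame, hv.2⟩) _ fun w hw => ?_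
  rw [← card_lifts hp2 hQ hB hw.1]
  congr 1
  refine Nat.card_congr (Equiv.subtypeEquivRight fun v => ⟨fun h => ⟨h.1.1, h.2⟩, fun h => ?_⟩)
  obtain ⟨h, rfl⟩ := h
  exact ⟨⟨h, hw.2⟩, rfl⟩

theorem card_liftFrames_last (hp2 : p ≠ 2) (hQ : Q.IsSymm)
    (hB : (modForm (ZMod p) Q).Nondegenerate) {K : Fin m → ZMod (p ^ 2)}
    (hK : modForm _ Q K K = 0) (n : ℕ) :
    (Nat.card {v : Fin (n + 1) → Fin m → ZMod (p ^ 2) // IsLiftFrame Q v ∧ v (Fin.last n) = K} : ℚ)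
      = Nat.card {w : Fin n → Fin m → ZMod p //
          IsFrame (modForm _ Q) (Fin.snoc w (red p m K) : Fin (n + 1) → _)} *
        ∏ i ∈ Finset.range n, (p : ℚ) ^ m / (p : ℚ) ^ (i + 2) := by
  rw [natCard_last_eq]
  refine natCard_subtype_fiber (red p m ∘ ·) (fun v hv => ?_) _ fun w hw => ?_
  · rw [← red_comp_snoc]; exact hv.isFrame
  · exact card_lifts_snoc hp2 hQ hB hK hw

end Lifts

/-! ### Isotropic subgroups of `(ℤ/p²)^m` and the frames that determine them. -/

section Neighbors

variable {p : ℕ} [Fact p.Prime] {m : ℕ} {Q : Matrix (Fin m) (Fin m) ℤ}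

/-- The image modulo `p ^ 2` of a lattice whose position relative to `ℤ ^ m` is given by
`diag(1_d, p 1_(m - 2 d), p ^ 2 1_d)` and on which the form vanishes modulo `p ^ 2`. -/
def IsNeighbor (p : ℕ) (Q : Matrix (Fin m) (Fin m) ℤ) (d : ℕ)
    (S : AddSubgroup (Fin m → ZMod (p ^ 2))) : Prop :=
  Nat.card S = p ^ m ∧ Nat.card (S.map (red p m)) = p ^ d ∧ ∀ x ∈ S, modForm _ Q x x = 0

/-- The neighbor spanned by a frame. -/
def frameNeighbor (Q : Matrix (Fin m) (Fin m) ℤ) {n : ℕ} (v : Fin n → Fin m → ZMod (p ^ 2)) :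
    AddSubgroup (Fin m → ZMod (p ^ 2)) where
  carrier := {x | red p m x ∈ Submodule.span (ZMod p) (Set.range (red p m ∘ v)) ∧
    ∀ i, modForm _ Q (v i) x = 0}
  add_mem' := fun hx hy => ⟨by rw [map_add]; exact Submodule.add_mem _ hx.1 hy.1,
    fun i => by rw [map_add, hx.2 i, hy.2 i, add_zero]⟩
  zero_mem' := ⟨by rw [map_zero]; exact Submodule.zero_mem _, fun i => map_zero _⟩
  neg_mem' := fun hx => ⟨by rw [map_neg]; exact Submodule.neg_mem _ hx.1,
    fun i => by rw [map_neg, hx.2 i, neg_zero]⟩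

theorem mem_frameNeighbor {n : ℕ} {v : Fin n → Fin m → ZMod (p ^ 2)} {x : Fin m → ZMod (p ^ 2)} :
    x ∈ frameNeighbor Q v ↔ red p m x ∈ Submodule.span (ZMod p) (Set.range (red p m ∘ v)) ∧
      ∀ i, modForm _ Q (v i) x = 0 := Iff.rfl

theorem IsLiftFrame.mem {n : ℕ} {v : Fin n → Fin m → ZMod (p ^ 2)} (hv : IsLiftFrame Q v)
    (i : Fin n) : v i ∈ frameNeighbor Q v :=
  ⟨Submodule.subset_span ⟨i, rfl⟩, fun j => hv.2 j i⟩

theorem map_frameNeighbor {n : ℕ} {v : Fin n → Fin m → ZMod (p ^ 2)} (hv : IsLiftFrame Q v) :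
    AddSubgroup.toZModSubmodule p ((frameNeighbor Q v).map (red p m)) =
      Submodule.span (ZMod p) (Set.range (red p m ∘ v)) := by
  apply le_antisymm
  · rintro _ ⟨x, hx, rfl⟩
    exact hx.1
  · rw [Submodule.span_le]
    rintro _ ⟨i, rfl⟩
    exact ⟨v i, hv.mem i, rfl⟩

theorem card_map_frameNeighbor {n : ℕ} {v : Fin n → Fin m → ZMod (p ^ 2)}
    (hv : IsLiftFrame Q v) : Nat.card ((frameNeighbor Q v).map (red p m)) = p ^ n := by
  have h := card_span_of_linearIndependent hv.1
  rw [← map_frameNeighbor hv, Nat.card_zmod] at h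
  exact h

theorem exists_combination {n : ℕ} {v : Fin n → Fin m → ZMod (p ^ 2)} {x : Fin m → ZMod (p ^ 2)}
    (hx : red p m x ∈ Submodule.span (ZMod p) (Set.range (red p m ∘ v))) :
    ∃ (c : Fin n → ℤ) (y : Fin m → ZMod p),
      x = ∑ i, (c i : ZMod (p ^ 2)) • v i + inj p m y := by
  obtain ⟨c, hc⟩ := (Submodule.mem_span_range_iff_exists_fun _).1 hx
  choose c' hc' using fun i => ZMod.intCast_surjective (c i)
  obtain ⟨y, hy⟩ := exists_inj_eq (x := x - ∑ i, (c' i : ZMod (p ^ 2)) • v i) (by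
    rw [map_sub, map_sum, ← hc, sub_eq_zero]
    exact Finset.sum_congr rfl fun i _ => by rw [red_intCast_smul, hc']; rfl)
  exact ⟨c', y, by rw [hy]; abel⟩

/-- Write `x = ∑ c_i v_i + p y`. As `x` is orthogonal to the frame, only `p B(y, x)` survives. The
same orthogonality makes `y` orthogonal to the frame modulo `p`, hence to the reduction of `x`. -/
theorem modForm_self_of_mem_frameNeighbor (hQ : Q.IsSymm) {n : ℕ}
    {v : Fin n → Fin m → ZMod (p ^ 2)} (hv : IsLiftFrame Q v) {x : Fin m → ZMod (p ^ 2)}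
    (hx : x ∈ frameNeighbor Q v) : modForm _ Q x x = 0 := by
  obtain ⟨c, y, hxy⟩ := exists_combination hx.1
  have hsE := modForm_isSymm (R := ZMod (p ^ 2)) hQ
  have h1 : ∀ i, modForm (ZMod p) Q y (red p m (v i)) = 0 := by
    intro i
    apply mulHom_injective
    rw [← modForm_inj, map_zero]
    have h2 := hx.2 i
    rw [hxy, map_add, map_sum, Finset.sum_eq_zero, zero_add, hsE.eq] at h2
    · exact h2
    · intro j _
      rw [map_smul, hv.2, smul_zero]
  have h3 : ∀ z ∈ Submodule.span (ZMod p) (Set.range (red p m ∘ v)), modForm (ZMod p) Q y z = 0 := by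
    intro z hz
    induction hz using Submodule.span_induction with
    | mem z hz => obtain ⟨i, rfl⟩ := hz; exact h1 i
    | zero => simp
    | add x y _ _ h1 h2 => simp [h1, h2]
    | smul a x _ h => simp [h]
  have h4 : modForm _ Q (∑ i, (c i : ZMod (p ^ 2)) • v i) x = 0 := by
    rw [hsE.eq, map_sum]
    refine Finset.sum_eq_zero fun i _ => ?_
    rw [map_smul, hsE.eq, hx.2, smul_zero]
  calc modForm _ Q x x = modForm _ Q (∑ i, (c i : ZMod (p ^ 2)) • v i + inj p m y) x := by
        rw [← hxy]
    _ = 0 := by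
      rw [LinearMap.BilinForm.add_left, h4, modForm_inj, h3 _ hx.1, map_zero, add_zero]

theorem card_fiber_mul_card_map (S : AddSubgroup (Fin m → ZMod (p ^ 2))) {w : Fin m → ZMod p}
    (hw : w ∈ S.map (red p m)) :
    Nat.card {x // x ∈ S ∧ red p m x = w} * Nat.card (S.map (red p m)) = Nat.card S := by
  rw [← natCard_fiber_of_surjective _ ((red p m).addSubgroupMap_surjective S) ⟨w, hw⟩]
  congr 1
  refine Nat.card_congr ((Equiv.subtypeSubtypeEquivSubtypeInter (· ∈ S) _).symm.trans
    (Equiv.subtypeEquivRight fun x => ?_))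
  rw [Subtype.ext_iff]
  rfl

/-- Reduction has image of order `p^n`, and its kernel is `p` times the orthogonal complement of the
reduced frame, of order `p^(m-n)`. -/
theorem card_frameNeighbor (hQ : Q.IsSymm) (hB : (modForm (ZMod p) Q).Nondegenerate) {n : ℕ}
    {v : Fin n → Fin m → ZMod (p ^ 2)} (hv : IsLiftFrame Q v) :
    Nat.card (frameNeighbor Q v) = p ^ m := by
  have h1 := card_fiber_mul_card_map (frameNeighbor Q v) (zero_mem _)
  have h2 := card_system (B := modForm (ZMod p) Q) (H := ⊤) (w := red p m ∘ v) (fun c => by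
    obtain ⟨y, hy⟩ := exists_apply_eq hB (modForm_isSymm hQ) hv.1 c
    exact ⟨y, Submodule.mem_top, hy⟩) 0
  have h3 : Nat.card (⊤ : Submodule (ZMod p) (Fin m → ZMod p)) = p ^ m := by
    rw [Nat.card_congr Submodule.topEquiv.toEquiv, Nat.card_fun, Nat.card_zmod, Nat.card_fin]
  rw [← h1, ← h3, ← h2, card_map_frameNeighbor hv, Nat.card_zmod]
  congr 1
  symm
  refine Nat.card_congr (Equiv.ofBijective (fun y => ⟨inj p m y.1, ⟨?_, ?_⟩, red_inj _⟩)
    ⟨fun y z h => ?_, fun x => ?_⟩)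
  · rw [red_inj]; exact zero_mem _
  · intro i
    rw [(modForm_isSymm hQ).eq, modForm_inj, (modForm_isSymm hQ).eq]
    have := y.2.2 i
    rw [Function.comp_apply] at this
    rw [this, Pi.zero_apply, map_zero]
  · exact Subtype.ext (inj_injective (congrArg Subtype.val h))
  · obtain ⟨x, hx, hx0⟩ := x
    obtain ⟨y, rfl⟩ := exists_inj_eq hx0
    refine ⟨⟨y, Submodule.mem_top, fun i => mulHom_injective ?_⟩, rfl⟩
    rw [(modForm_isSymm hQ).eq, Function.comp_apply, ← modForm_inj, (modForm_isSymm hQ).eq, hx.2 i,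
      Pi.zero_apply, map_zero]

theorem isNeighbor_frameNeighbor (hQ : Q.IsSymm) (hB : (modForm (ZMod p) Q).Nondegenerate) {d : ℕ}
    {v : Fin d → Fin m → ZMod (p ^ 2)} (hv : IsLiftFrame Q v) :
    IsNeighbor p Q d (frameNeighbor Q v) :=
  ⟨card_frameNeighbor hQ hB hv, card_map_frameNeighbor hv,
    fun _ hx => modForm_self_of_mem_frameNeighbor hQ hv hx⟩

theorem IsNeighbor.modForm_eq_zero (hp2 : p ≠ 2) (hQ : Q.IsSymm) {d : ℕ}
    {S : AddSubgroup (Fin m → ZMod (p ^ 2))} (hS : IsNeighbor p Q d S) {x y : Fin m → ZMod (p ^ 2)}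
    (hx : x ∈ S) (hy : y ∈ S) : modForm _ Q x y = 0 := by
  have h := hS.2.2 (x + y) (S.add_mem hx hy)
  rw [LinearMap.BilinForm.add_left, map_add, map_add, hS.2.2 x hx, hS.2.2 y hy,
    (modForm_isSymm hQ).eq y x, zero_add, add_zero, ← two_mul] at h
  exact (isUnit_two_zmod_sq hp2).mul_right_eq_zero.1 h

theorem IsNeighbor.isLiftFrame (hp2 : p ≠ 2) (hQ : Q.IsSymm) {d : ℕ}
    {S : AddSubgroup (Fin m → ZMod (p ^ 2))} (hS : IsNeighbor p Q d S) {n : ℕ}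
    {v : Fin n → Fin m → ZMod (p ^ 2)} (hvS : ∀ i, v i ∈ S)
    (hv : LinearIndependent (ZMod p) (red p m ∘ v)) : IsLiftFrame Q v :=
  ⟨hv, fun i j => hS.modForm_eq_zero hp2 hQ (hvS i) (hvS j)⟩

/-- Polarization gives one inclusion; both groups have order `p^m`. -/
theorem IsNeighbor.eq_frameNeighbor (hp2 : p ≠ 2) (hQ : Q.IsSymm)
    (hB : (modForm (ZMod p) Q).Nondegenerate) {d : ℕ}
    {S : AddSubgroup (Fin m → ZMod (p ^ 2))} (hS : IsNeighbor p Q d S)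
    {v : Fin d → Fin m → ZMod (p ^ 2)} (hvS : ∀ i, v i ∈ S)
    (hv : LinearIndependent (ZMod p) (red p m ∘ v)) : S = frameNeighbor Q v := by
  have hL := hS.isLiftFrame hp2 hQ hvS hv
  have h1 : Submodule.span (ZMod p) (Set.range (red p m ∘ v)) =
      AddSubgroup.toZModSubmodule p (S.map (red p m)) := by
    refine SetLike.coe_injective (Set.eq_of_subset_of_ncard_le ?_ ?_ (Set.toFinite _))
    · refine Submodule.span_le.2 ?_
      rintro _ ⟨i, rfl⟩
      exact ⟨v i, hvS i, rfl⟩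
    · change Nat.card _ ≤ Nat.card _
      rw [SetLike.coe_sort_coe, SetLike.coe_sort_coe, card_span_of_linearIndependent hv,
        Nat.card_zmod]
      exact hS.2.1.le
  have h2 : S ≤ frameNeighbor Q v := fun x hx =>
    ⟨by rw [h1]; exact ⟨x, hx, rfl⟩, fun i => hS.modForm_eq_zero hp2 hQ (hvS i) hx⟩
  refine SetLike.coe_injective (Set.eq_of_subset_of_ncard_le h2 ?_ (Set.toFinite _))
  change Nat.card (frameNeighbor Q v) ≤ Nat.card S
  rw [card_frameNeighbor hQ hB hL, hS.1]

/-- Double counting of pairs (subgroup, adapted frame). The condition `A` on frames must force `P`,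
and each subgroup satisfying `P` must carry the same number `c` of frames satisfying `A`. -/
theorem card_neighbors_mul (hp2 : p ≠ 2) (hQ : Q.IsSymm)
    (hB : (modForm (ZMod p) Q).Nondegenerate) {d : ℕ}
    (A : (Fin d → Fin m → ZMod (p ^ 2)) → Prop) (P : AddSubgroup (Fin m → ZMod (p ^ 2)) → Prop)
    (c : ℚ) (hAP : ∀ v, IsLiftFrame Q v → A v → P (frameNeighbor Q v))
    (hc : ∀ S, IsNeighbor p Q d S → P S → (Nat.card {v : Fin d → Fin m → ZMod (p ^ 2) //
      (∀ i, v i ∈ S) ∧ LinearIndependent (ZMod p) (red p m ∘ v) ∧ A v} : ℚ) = c) :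
    (Nat.card {v // IsLiftFrame Q v ∧ A v} : ℚ) = Nat.card {S // IsNeighbor p Q d S ∧ P S} * c := by
  refine natCard_subtype_fiber (frameNeighbor Q)
    (fun v hv => ⟨isNeighbor_frameNeighbor hQ hB hv.1, hAP v hv.1 hv.2⟩) c fun S hS => ?_
  rw [← hc S hS.1 hS.2]
  congr 1
  refine Nat.card_congr (Equiv.subtypeEquivRight fun v => ⟨?_, ?_⟩)
  · rintro ⟨⟨hv, hA⟩, rfl⟩
    exact ⟨hv.mem, hv.1, hA⟩
  · rintro ⟨hvS, hv, hA⟩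
    exact ⟨⟨hS.1.isLiftFrame hp2 hQ hvS hv, hA⟩, (hS.1.eq_frameNeighbor hp2 hQ hB hvS hv).symm⟩

theorem IsNeighbor.card_tuples {d : ℕ} {S : AddSubgroup (Fin m → ZMod (p ^ 2))}
    (hS : IsNeighbor p Q d S) {n : ℕ} (R : (Fin n → Fin m → ZMod p) → Prop) :
    (Nat.card {v : Fin n → Fin m → ZMod (p ^ 2) // (∀ i, v i ∈ S) ∧ R (red p m ∘ v)} : ℚ) =
      Nat.card {w // R w ∧ ∀ i, w i ∈ AddSubgroup.toZModSubmodule p (S.map (red p m))} *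
        ((p : ℚ) ^ m / (p : ℚ) ^ d) ^ n := by
  refine natCard_subtype_fiber (red p m ∘ ·) (fun v hv => ⟨hv.2, fun i => ⟨v i, hv.1 i, rfl⟩⟩) _
    fun w hw => ?_
  have hp0 : (p : ℚ) ≠ 0 := by exact_mod_cast (Fact.out : p.Prime).ne_zero
  have h1 : ∀ i, (Nat.card {x // x ∈ S ∧ red p m x = w i} : ℚ) = (p : ℚ) ^ m / (p : ℚ) ^ d := by
    intro i
    have := card_fiber_mul_card_map S (hw.2 i)
    rw [hS.1, hS.2.1] at this
    rw [eq_div_iff (pow_ne_zero _ hp0)]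
    exact_mod_cast this
  have h2 : Nat.card {v // ((∀ i, v i ∈ S) ∧ R (red p m ∘ v)) ∧ red p m ∘ v = w} =
      Nat.card (∀ i, {x // x ∈ S ∧ red p m x = w i}) := by
    refine Nat.card_congr ((Equiv.subtypeEquivRight fun v => ?_).trans Equiv.subtypePiEquivPi)
    rw [funext_iff]
    constructor
    · exact fun h i => ⟨h.1.1 i, h.2 i⟩
    · refine fun h => ⟨⟨fun i => (h i).1, ?_⟩, fun i => (h i).2⟩
      rw [show red p m ∘ v = w from funext fun i => (h i).2]
      exact hw.1
  rw [h2, Nat.card_pi, Nat.cast_prod, Finset.prod_congr rfl fun i _ => h1 i, Finset.prod_const,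
    Finset.card_univ, Fintype.card_fin]

end Neighbors

/-! ### Column lattices, unimodular cosets and elementary divisors. -/

section Lattices

variable {m : ℕ}

/-- Coordinatewise reduction of integral vectors modulo `n`. -/
def intRed (n m : ℕ) : (Fin m → ℤ) →+ (Fin m → ZMod n) :=
  (Int.castAddHom (ZMod n)).compLeft (Fin m)

theorem intRed_apply (n : ℕ) (x : Fin m → ℤ) (i : Fin m) : intRed n m x i = (x i : ZMod n) := rfl

theorem intRed_surjective (n : ℕ) : Function.Surjective (intRed n m) := fun y => by
  choose x hx using fun i => ZMod.intCast_surjective (y i)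
  exact ⟨x, funext hx⟩

theorem red_intRed (p : ℕ) (x : Fin m → ℤ) : red p m (intRed (p ^ 2) m x) = intRed p m x := by
  ext i
  simp [red_apply, intRed_apply]

theorem intRed_mulVec (n : ℕ) (M : Matrix (Fin m) (Fin m) ℤ) (x : Fin m → ℤ) :
    intRed n m (M.mulVec x) = (M.map (Int.castRingHom (ZMod n))).mulVec (intRed n m x) :=
  funext fun i => RingHom.map_mulVec (Int.castRingHom (ZMod n)) M x i

theorem modForm_intRed (n : ℕ) (Q : Matrix (Fin m) (Fin m) ℤ) (x y : Fin m → ℤ) :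
    modForm (ZMod n) Q (intRed n m x) (intRed n m y) = ((modForm ℤ Q x y : ℤ) : ZMod n) := by
  simp [modForm_apply, intRed_apply]

theorem modForm_formMatrix_self (q : QuadraticForm ℤ (Fin m → ℤ)) (x : Fin m → ℤ) :
    modForm ℤ (formMatrix q) x x = 2 * q x := by
  have h : formMatrix q = LinearMap.BilinForm.toMatrix' (QuadraticMap.polarBilin q) := by
    ext i j
    simp [formMatrix, LinearMap.BilinForm.toMatrix'_apply]
  rw [modForm, h]
  have h2 : (LinearMap.BilinForm.toMatrix' (QuadraticMap.polarBilin q)).map (Int.cast : ℤ → ℤ) =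
      LinearMap.BilinForm.toMatrix' (QuadraticMap.polarBilin q) := by ext; simp
  rw [h2, Matrix.toBilin'_toMatrix', QuadraticMap.polarBilin_apply_apply, QuadraticMap.polar_self]
  simp

theorem formMatrix_isSymm (q : QuadraticForm ℤ (Fin m → ℤ)) : (formMatrix q).IsSymm :=
  Matrix.IsSymm.ext fun i j => by simp [formMatrix, QuadraticMap.polar_comm]

/-- The lattice spanned by the columns of a matrix. -/
def columnLattice (M : Matrix (Fin m) (Fin m) ℤ) : AddSubgroup (Fin m → ℤ) :=
  (LinearMap.range M.mulVecLin).toAddSubgroup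

theorem mem_columnLattice {M : Matrix (Fin m) (Fin m) ℤ} {x : Fin m → ℤ} :
    x ∈ columnLattice M ↔ ∃ y, M.mulVec y = x := Iff.rfl

theorem columnLattice_mul_unit (M : Matrix (Fin m) (Fin m) ℤ) (V : GL (Fin m) ℤ) :
    columnLattice (M * V.1) = columnLattice M := by
  ext x
  simp only [mem_columnLattice]
  constructor
  · rintro ⟨y, rfl⟩
    exact ⟨V.1.mulVec y, by rw [Matrix.mulVec_mulVec]⟩
  · rintro ⟨y, rfl⟩
    refine ⟨V⁻¹.1.mulVec y, ?_⟩
    rw [Matrix.mulVec_mulVec, Matrix.mul_assoc, ← Units.val_mul, mul_inv_cancel, Units.val_one,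
      Matrix.mul_one]

theorem mem_unimodularCoset_iff {M N : Matrix (Fin m) (Fin m) ℤ} (hM : M.det ≠ 0) :
    N ∈ unimodularCoset M ↔ columnLattice N = columnLattice M := by
  constructor
  · rintro ⟨V, rfl⟩
    exact columnLattice_mul_unit M V
  · intro h
    have hNM : ∃ Y : Matrix (Fin m) (Fin m) ℤ, N = M * Y := by
      have : ∀ j, ∃ y, M.mulVec y = N.mulVec (Pi.single j 1) := fun j =>
        mem_columnLattice.1 (h ▸ mem_columnLattice.2 ⟨_, rfl⟩)
      choose y hy using this
      refine ⟨Matrix.of fun i j => y j i, ?_⟩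
      ext i j
      have := congrFun (hy j) i
      rw [Matrix.mulVec_single_one] at this
      exact this.symm
    have hMN : ∃ Z : Matrix (Fin m) (Fin m) ℤ, M = N * Z := by
      have : ∀ j, ∃ y, N.mulVec y = M.mulVec (Pi.single j 1) := fun j =>
        mem_columnLattice.1 (h ▸ mem_columnLattice.2 ⟨_, rfl⟩)
      choose y hy using this
      refine ⟨Matrix.of fun i j => y j i, ?_⟩
      ext i j
      have := congrFun (hy j) i
      rw [Matrix.mulVec_single_one] at this
      exact this.symm
    obtain ⟨Y, hY⟩ := hNM
    obtain ⟨Z, hZ⟩ := hMN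
    have h1 : Y * Z = 1 := by
      have h2 : M * (Y * Z - 1) = 0 := by
        rw [Matrix.mul_sub, ← Matrix.mul_assoc, ← hY, ← hZ, Matrix.mul_one, sub_self]
      ext i j
      have h3 := Matrix.eq_zero_of_mulVec_eq_zero hM (v := fun i => (Y * Z - 1) i j)
        (funext fun i => congrFun (congrFun h2 i) j)
      have := congrFun h3 i
      simpa [sub_eq_zero] using this
    exact ⟨⟨Y, Z, h1, mul_eq_one_comm.1 h1⟩, hY⟩

/-- The matrix `U` stays injective modulo `n`, so the image is a product of the cyclic groups
generated by the `a i`. -/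
theorem card_map_columnLattice (n : ℕ) [NeZero n] (U : GL (Fin m) ℤ) (a : Fin m → ℤ) :
    Nat.card ((columnLattice (U.1 * Matrix.diagonal a)).map (intRed n m)) =
      ∏ i, addOrderOf (a i : ZMod n) := by
  have hU : Function.Injective (U.1.map (Int.castRingHom (ZMod n))).mulVec := by
    have h : (U⁻¹.1.map (Int.castRingHom (ZMod n))) * (U.1.map (Int.castRingHom (ZMod n))) = 1 := by
      rw [← Matrix.map_mul, ← Units.val_mul, inv_mul_cancel, Units.val_one,
        Matrix.map_one _ (map_zero _) (map_one _)]
    refine Function.LeftInverse.injective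
      (g := (U⁻¹.1.map (Int.castRingHom (ZMod n))).mulVec) fun x => ?_
    rw [Matrix.mulVec_mulVec, h, Matrix.one_mulVec]
  simp only [← Nat.card_zmultiples]
  rw [← Nat.card_pi]
  symm
  have key : ∀ y : Fin m → ℤ, intRed n m ((U.1 * Matrix.diagonal a).mulVec y) =
      (U.1.map (Int.castRingHom (ZMod n))).mulVec fun i => y i • (a i : ZMod n) := by
    intro y
    rw [← Matrix.mulVec_mulVec, intRed_mulVec]
    congr 1
    ext i
    rw [intRed_apply, Matrix.mulVec_diagonal]
    simp [mul_comm]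
  refine Nat.card_congr (Equiv.ofBijective (fun t =>
    ⟨(U.1.map (Int.castRingHom (ZMod n))).mulVec fun i => (t i : ZMod n), ?_⟩)
    ⟨fun s t h => ?_, fun x => ?_⟩)
  · choose y hy using fun i => AddSubgroup.mem_zmultiples_iff.1 (t i).2
    refine ⟨_, mem_columnLattice.2 ⟨y, rfl⟩, ?_⟩
    rw [key]
    simp only [hy]
  · have := hU (congrArg Subtype.val h)
    exact funext fun i => Subtype.ext (congrFun this i)
  · obtain ⟨_, x, hx, rfl⟩ := x
    obtain ⟨y, rfl⟩ := mem_columnLattice.1 hx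
    exact ⟨fun i => ⟨_, AddSubgroup.mem_zmultiples_iff.2 ⟨y i, rfl⟩⟩, Subtype.ext (key y).symm⟩

theorem addOrderOf_prime_pow_cast {p : ℕ} [Fact p.Prime] (r e : ℕ) :
    addOrderOf (((p : ℤ) ^ e : ℤ) : ZMod (p ^ r)) = p ^ (r - e) := by
  have hp := (Fact.out : p.Prime)
  have h : (((p : ℤ) ^ e : ℤ) : ZMod (p ^ r)) = ((p ^ e : ℕ) : ZMod (p ^ r)) := by push_cast; rfl
  have hr : p ^ r ≠ 0 := pow_ne_zero _ hp.ne_zero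
  rw [h, ZMod.addOrderOf_coe _ hr]
  rcases le_total e r with h | h
  · rw [Nat.gcd_eq_right (pow_dvd_pow p h), Nat.pow_div h hp.pos]
  · rw [Nat.gcd_eq_left (pow_dvd_pow p h), Nat.div_self (Nat.pos_of_ne_zero hr), Nat.sub_eq_zero_of_le h,
      pow_zero]

/-- Truncated subtraction is intended: entries divisible by `p^r` contribute nothing. The cases `r =
1, 2` suffice to recover exponents that are at most `2`. -/
theorem card_map_columnLattice_pow {p : ℕ} [Fact p.Prime] (r : ℕ) (U : GL (Fin m) ℤ)
    (e : Fin m → ℕ) :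
    Nat.card ((columnLattice (U.1 * Matrix.diagonal fun i => (p : ℤ) ^ e i)).map (intRed (p ^ r) m)) =
      p ^ ∑ i, (r - e i) := by
  have : NeZero (p ^ r) := ⟨pow_ne_zero _ (Fact.out : p.Prime).ne_zero⟩
  rw [card_map_columnLattice, ← Finset.prod_pow_eq_pow_sum]
  exact Finset.prod_congr rfl fun i _ => addOrderOf_prime_pow_cast r (e i)

/-- The exponents of the diagonal entries of `elemDivMatrix`. -/
def elemDivExp (m d : ℕ) (i : Fin m) : ℕ :=
  if (i : ℕ) < d then 0 else if (i : ℕ) < d + (m - 2 * d) then 1 else 2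

theorem elemDivMatrix_eq (p m d : ℕ) :
    elemDivMatrix p m d = Matrix.diagonal fun i => (p : ℤ) ^ elemDivExp m d i := by
  rw [elemDivMatrix]
  congr 1
  ext i
  rw [elemDivExp]
  split_ifs <;> simp

theorem elemDivExp_le (m d : ℕ) (i : Fin m) : elemDivExp m d i ≤ 2 := by
  rw [elemDivExp]; split_ifs <;> omega

theorem sum_elemDivExp (r : ℕ) {d : ℕ} (hd : 2 * d ≤ m) :
    ∑ i, (r - elemDivExp m d i) = d * r + (m - 2 * d) * (r - 1) + d * (r - 2) := by
  obtain ⟨b, rfl⟩ : ∃ b, m = d + b + d := ⟨m - 2 * d, by omega⟩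
  have h := Fin.sum_univ_eq_sum_range (fun i => r - if i < d then 0 else
    if i < d + (d + b + d - 2 * d) then 1 else 2) (d + b + d)
  have hb : d + b + d - 2 * d = b := by omega
  simp only [elemDivExp]
  rw [h, hb, Finset.sum_range_add, Finset.sum_range_add]
  congr 1
  · congr 1
    · rw [Finset.sum_congr rfl (g := fun _ => r)]
      · simp
      · intro i hi
        rw [if_pos (Finset.mem_range.1 hi), Nat.sub_zero]
    · rw [Finset.sum_congr rfl (g := fun _ => r - 1)]
      · simp
      · intro i hi
        rw [if_neg (by omega), if_pos (by have := Finset.mem_range.1 hi; omega)]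
  · rw [Finset.sum_congr rfl (g := fun _ => r - 2)]
    · simp
    · intro i hi
      rw [if_neg (by omega), if_neg (by omega)]

/-- The first sum is the number of zeros, the second then gives the number of ones, and the twos are
the remainder. -/
theorem exists_perm_of_sums {d : ℕ} (hd : 2 * d ≤ m) {e : Fin m → ℕ} (he : ∀ i, e i ≤ 2)
    (h1 : ∑ i, (1 - e i) = d) (h2 : ∑ i, (2 - e i) = m) :
    ∃ σ : Fin m ≃ Fin m, ∀ i, elemDivExp m d (σ i) = e i := by
  have key : ∀ f : Fin m → ℕ, (∀ i, f i ≤ 2) → ∑ i, (1 - f i) = d → ∑ i, (2 - f i) = m →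
      ∀ c, (Finset.univ.filter fun i => f i = c).card =
        if c = 0 then d else if c = 1 then m - 2 * d else if c = 2 then d else 0 := by
    intro f hf h1 h2 c
    have e0 : (Finset.univ.filter fun i => f i = 0).card = ∑ i, (1 - f i) := by
      rw [Finset.card_filter]
      refine Finset.sum_congr rfl fun i _ => ?_
      split_ifs <;> omega
    have e1 : (Finset.univ.filter fun i => f i = 1).card + 2 * ∑ i, (1 - f i) =
        ∑ i, (2 - f i) := by
      rw [Finset.card_filter, Finset.mul_sum, ← Finset.sum_add_distrib]
      refine Finset.sum_congr rfl fun i _ => ?_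
      split_ifs <;> omega
    have e2 : (Finset.univ.filter fun i => f i = 0).card +
        (Finset.univ.filter fun i => f i = 1).card +
        (Finset.univ.filter fun i => f i = 2).card = m := by
      rw [Finset.card_filter, Finset.card_filter, Finset.card_filter, ← Finset.sum_add_distrib,
        ← Finset.sum_add_distrib]
      conv_rhs => rw [← Fintype.card_fin m, ← Finset.card_univ, Finset.card_eq_sum_ones]
      refine Finset.sum_congr rfl fun i _ => ?_
      have := hf i
      split_ifs <;> omega
    split_ifs with hc hc hc
    · subst hc; omega
    · subst hc; omega
    · subst hc; omega
    · rw [Finset.card_eq_zero, Finset.filter_eq_empty_iff]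
      intro i _ h
      have := hf i
      omega
  have k1 := key e he h1 h2
  have k2 := key (elemDivExp m d) (elemDivExp_le m d) (by rw [sum_elemDivExp 1 hd]; omega)
    (by rw [sum_elemDivExp 2 hd]; omega)
  have hcard : ∀ c, Nonempty ({i // e i = c} ≃ {i // elemDivExp m d i = c}) := fun c => by
    refine ⟨Fintype.equivOfCardEq ?_⟩
    rw [Fintype.card_subtype, Fintype.card_subtype, k1, k2]
  exact ⟨Equiv.ofFiberEquiv fun c => (hcard c).some, fun i => Equiv.ofFiberEquiv_map _ i⟩

/-- The unimodular matrix whose columns are the members of a basis of `ℤ ^ m`. -/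
noncomputable def basisGL (b : Module.Basis (Fin m) ℤ (Fin m → ℤ)) : GL (Fin m) ℤ :=
  ⟨(Pi.basisFun ℤ (Fin m)).toMatrix b, b.toMatrix (Pi.basisFun ℤ (Fin m)),
    Module.Basis.toMatrix_mul_toMatrix_flip _ _, Module.Basis.toMatrix_mul_toMatrix_flip _ _⟩

theorem mem_columnLattice_basisGL (b : Module.Basis (Fin m) ℤ (Fin m → ℤ)) (a : Fin m → ℤ)
    (x : Fin m → ℤ) :
    x ∈ columnLattice ((basisGL b).1 * Matrix.diagonal a) ↔ ∀ i, a i ∣ b.repr x i := by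
  have h : (basisGL b)⁻¹.1.mulVec x = b.repr x := by
    exact Module.Basis.toMatrix_mulVec_repr (Pi.basisFun ℤ (Fin m)) b x
  rw [mem_columnLattice]
  constructor
  · rintro ⟨y, rfl⟩ i
    rw [← h, Matrix.mulVec_mulVec, ← Matrix.mul_assoc, ← Units.val_mul, inv_mul_cancel,
      Units.val_one, Matrix.one_mul, Matrix.mulVec_diagonal]
    exact dvd_mul_right _ _
  · intro hx
    choose y hy using hx
    refine ⟨y, ?_⟩
    have h2 : (Matrix.diagonal a).mulVec y = (basisGL b)⁻¹.1.mulVec x := by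
      rw [h]
      ext i
      rw [Matrix.mulVec_diagonal, hy]
    rw [← Matrix.mulVec_mulVec, h2, Matrix.mulVec_mulVec, ← Units.val_mul, mul_inv_cancel,
      Units.val_one, Matrix.one_mulVec]

end Lattices

/-! ### Cosets correspond to isotropic subgroups modulo `p²`. -/

section Cosets

variable {p : ℕ} [Fact p.Prime] {m : ℕ}

theorem intRed_eq_zero_iff {n : ℕ} {x : Fin m → ℤ} :
    intRed n m x = 0 ↔ ∃ y : Fin m → ℤ, x = (n : ℤ) • y := by
  constructor
  · intro h
    have : ∀ i, (n : ℤ) ∣ x i := fun i => by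
      rw [← ZMod.intCast_zmod_eq_zero_iff_dvd]
      exact congrFun h i
    choose y hy using this
    exact ⟨y, funext hy⟩
  · rintro ⟨y, rfl⟩
    ext i
    simp [intRed_apply]

theorem map_red_map_intRed (L : AddSubgroup (Fin m → ℤ)) :
    (L.map (intRed (p ^ 2) m)).map (red p m) = L.map (intRed p m) := by
  rw [AddSubgroup.map_map]
  exact congrArg (AddSubgroup.map · L) (AddMonoidHom.ext fun x => red_intRed p x)

theorem det_ne_zero_of_mem {d : ℕ} {M : Matrix (Fin m) (Fin m) ℤ}
    (hM : M ∈ unimodularDoubleCoset (elemDivMatrix p m d)) : M.det ≠ 0 := by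
  obtain ⟨U, V, rfl⟩ := hM
  have hp : (p : ℤ) ≠ 0 := by exact_mod_cast (Fact.out : p.Prime).ne_zero
  have hu : ∀ W : GL (Fin m) ℤ, W.1.det ≠ 0 := fun W =>
    ((Matrix.isUnit_iff_isUnit_det _).1 W.isUnit).ne_zero
  rw [Matrix.det_mul, Matrix.det_mul, elemDivMatrix_eq, Matrix.det_diagonal]
  exact mul_ne_zero (mul_ne_zero (hu U) (Finset.prod_ne_zero_iff.2 fun i _ => pow_ne_zero _ hp))
    (hu V)

omit [Fact p.Prime] in
theorem smul_mem_columnLattice {d : ℕ} {M : Matrix (Fin m) (Fin m) ℤ}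
    (hM : M ∈ unimodularDoubleCoset (elemDivMatrix p m d)) (x : Fin m → ℤ) :
    ((p ^ 2 : ℕ) : ℤ) • x ∈ columnLattice M := by
  obtain ⟨U, V, rfl⟩ := hM
  rw [columnLattice_mul_unit, elemDivMatrix_eq, mem_columnLattice]
  refine ⟨fun i => (p : ℤ) ^ (2 - elemDivExp m d i) * U⁻¹.1.mulVec x i, ?_⟩
  have h : (Matrix.diagonal fun i => (p : ℤ) ^ elemDivExp m d i).mulVec
      (fun i => (p : ℤ) ^ (2 - elemDivExp m d i) * U⁻¹.1.mulVec x i) =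
      ((p ^ 2 : ℕ) : ℤ) • U⁻¹.1.mulVec x := by
    ext i
    rw [Matrix.mulVec_diagonal, ← mul_assoc, ← pow_add,
      Nat.add_sub_cancel' (elemDivExp_le m d i), Pi.smul_apply, smul_eq_mul]
    push_cast; rfl
  rw [← Matrix.mulVec_mulVec, h, Matrix.mulVec_smul, Matrix.mulVec_mulVec, ← Units.val_mul,
    mul_inv_cancel, Units.val_one, Matrix.one_mulVec]

omit [Fact p.Prime] in
theorem comap_map_columnLattice {d : ℕ} {M : Matrix (Fin m) (Fin m) ℤ}
    (hM : M ∈ unimodularDoubleCoset (elemDivMatrix p m d)) :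
    ((columnLattice M).map (intRed (p ^ 2) m)).comap (intRed (p ^ 2) m) = columnLattice M := by
  refine le_antisymm ?_ (AddSubgroup.le_comap_map _ _)
  rintro x ⟨y, hy, hyx⟩
  obtain ⟨z, hz⟩ := intRed_eq_zero_iff.1
    (show intRed (p ^ 2) m (x - y) = 0 by rw [map_sub, hyx, sub_self])
  rw [← sub_add_cancel x y, hz]
  exact AddSubgroup.add_mem _ (smul_mem_columnLattice hM z) hy

theorem card_columnLattice_of_mem {d : ℕ} (hd : 2 * d ≤ m) {M : Matrix (Fin m) (Fin m) ℤ}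
    (hM : M ∈ unimodularDoubleCoset (elemDivMatrix p m d)) :
    Nat.card ((columnLattice M).map (intRed (p ^ 2) m)) = p ^ m ∧
      Nat.card (((columnLattice M).map (intRed (p ^ 2) m)).map (red p m)) = p ^ d := by
  obtain ⟨U, V, rfl⟩ := hM
  rw [columnLattice_mul_unit, elemDivMatrix_eq, map_red_map_intRed]
  have h1 := card_map_columnLattice_pow (p := p) 1 U (elemDivExp m d)
  rw [pow_one] at h1
  rw [h1, card_map_columnLattice_pow, sum_elemDivExp _ hd, sum_elemDivExp _ hd]
  constructor <;> congr 1 <;> omega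

/-- The preimage of `S` in `ℤ^m` has full rank, so it has a Smith normal form; the two orders pin
down its elementary divisors up to order, and permuting the basis sorts them. -/
theorem exists_mem_doubleCoset {d : ℕ} (hd : 2 * d ≤ m) {S : AddSubgroup (Fin m → ZMod (p ^ 2))}
    (h1 : Nat.card S = p ^ m) (h2 : Nat.card (S.map (red p m)) = p ^ d) :
    ∃ M ∈ unimodularDoubleCoset (elemDivMatrix p m d),
      columnLattice M = S.comap (intRed (p ^ 2) m) := by
  have hp := (Fact.out : p.Prime)
  have hp0 : ((p ^ 2 : ℕ) : ℤ) ≠ 0 := by exact_mod_cast pow_ne_zero 2 hp.ne_zero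
  set L := S.comap (intRed (p ^ 2) m) with hL
  have hmem : ∀ x : Fin m → ℤ, ((p ^ 2 : ℕ) : ℤ) • x ∈ L := fun x => by
    rw [hL, AddSubgroup.mem_comap, intRed_eq_zero_iff.2 ⟨x, rfl⟩]
    exact zero_mem _
  have hrank : Module.finrank ℤ (AddSubgroup.toIntSubmodule L) = Module.finrank ℤ (Fin m → ℤ) := by
    refine le_antisymm (Submodule.finrank_le _) ?_
    let f : (Fin m → ℤ) →ₗ[ℤ] AddSubgroup.toIntSubmodule L :=
      (((p ^ 2 : ℕ) : ℤ) • LinearMap.id).codRestrict _ fun x => hmem x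
    refine LinearMap.finrank_le_finrank_of_injective (f := f) fun x y h => ?_
    have := congrArg Subtype.val h
    exact smul_right_injective _ hp0 this
  obtain ⟨b, a, c, hc⟩ := Submodule.exists_smith_normal_form_of_rank_eq
    (Pi.basisFun ℤ (Fin m)) hrank
  have hLa : ∀ x, x ∈ L ↔ ∀ i, a i ∣ b.repr x i := by
    intro x
    constructor
    · intro hx i
      have h3 := c.sum_repr ⟨x, hx⟩
      have h4 : x = ∑ j, (c.repr ⟨x, hx⟩ j * a j) • b j := by
        conv_lhs => rw [show x = ((⟨x, hx⟩ : AddSubgroup.toIntSubmodule L) : Fin m → ℤ) from rfl,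
          ← h3]
        rw [Submodule.coe_sum]
        refine Finset.sum_congr rfl fun j _ => ?_
        rw [Submodule.coe_smul, hc, smul_smul]
      rw [h4, b.repr_sum_self]
      exact dvd_mul_left _ _
    · intro hx
      choose y hy using hx
      rw [← b.sum_repr x]
      refine AddSubgroup.sum_mem _ fun i _ => ?_
      rw [hy, mul_comm, mul_smul, ← hc]
      exact (AddSubgroup.toIntSubmodule L).smul_mem _ (c i).2
  -- Since `p² b_i` lies in the lattice, `a i` divides `p²`. Its sign is irrelevant to the lattice.
  have ha : ∀ i, ∃ e ≤ 2, (a i).natAbs = p ^ e := fun i => by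
    have h3 := (hLa _).1 (hmem (b i)) i
    rw [map_smul, Finsupp.smul_apply, b.repr_self, Finsupp.single_eq_same, smul_eq_mul,
      mul_one] at h3
    exact (Nat.dvd_prime_pow hp).1 (Int.natAbs_dvd_natAbs.2 h3)
  choose e he hae using ha
  have hLe : ∀ x, x ∈ L ↔ ∀ i, (p : ℤ) ^ e i ∣ b.repr x i := fun x => by
    rw [hLa]
    refine forall_congr' fun i => ?_
    rw [← Int.natAbs_dvd, hae]
    push_cast; rfl
  have hcol : columnLattice ((basisGL b).1 * Matrix.diagonal fun i => (p : ℤ) ^ e i) = L := by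
    ext x
    rw [mem_columnLattice_basisGL, hLe]
  have hmap : L.map (intRed (p ^ 2) m) = S :=
    AddSubgroup.map_comap_eq_self_of_surjective (intRed_surjective _) S
  have hs2 := card_map_columnLattice_pow (p := p) 2 (basisGL b) e
  rw [hcol, hmap, h1] at hs2
  have hs1 := card_map_columnLattice_pow (p := p) 1 (basisGL b) e
  rw [pow_one, hcol, ← map_red_map_intRed, hmap, h2] at hs1
  obtain ⟨σ, hσ⟩ := exists_perm_of_sums hd he (Nat.pow_right_injective hp.two_le hs1).symm
    (Nat.pow_right_injective hp.two_le hs2).symm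
  refine ⟨(basisGL (b.reindex σ)).1 * elemDivMatrix p m d, ⟨basisGL (b.reindex σ), 1, by simp⟩, ?_⟩
  ext x
  rw [elemDivMatrix_eq, mem_columnLattice_basisGL, hLe]
  rw [← σ.forall_congr_right]
  simp [hσ]

/-- Dividing all values by `a` again gives a quadratic form, because its axioms may be checked after
multiplying by `a`. -/
theorem formCongrZero_iff (a : ℤ) (ha : a ≠ 0) (q : QuadraticForm ℤ (Fin m → ℤ)) :
    FormCongrZero a q ↔ ∀ x, a ∣ q x := by
  constructor
  · rintro ⟨q', rfl⟩ x
    exact ⟨q' x, rfl⟩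
  · intro h
    choose f hf using h
    have hpol : ∀ x y, a * QuadraticMap.polar f x y = QuadraticMap.polar q x y := fun x y => by
      simp only [QuadraticMap.polar, hf]; ring
    refine ⟨QuadraticMap.ofPolar f (fun c x => ?_) (fun x x' y => ?_) (fun c x y => ?_), ?_⟩
    · apply mul_left_cancel₀ ha
      rw [← hf, QuadraticMap.map_smul, hf]
      simp only [smul_eq_mul]; ring
    · apply mul_left_cancel₀ ha
      rw [mul_add, hpol, hpol, hpol, QuadraticMap.polar_add_left]
    · apply mul_left_cancel₀ ha
      rw [hpol, QuadraticMap.polar_smul_left, ← hpol]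
      simp only [smul_eq_mul]; ring
    · ext x
      exact hf x

theorem sq_dvd_iff_modForm (hp2 : p ≠ 2) (q : QuadraticForm ℤ (Fin m → ℤ)) (x : Fin m → ℤ) :
    (p : ℤ) ^ 2 ∣ q x ↔
      modForm (ZMod (p ^ 2)) (formMatrix q) (intRed _ m x) (intRed _ m x) = 0 := by
  rw [modForm_intRed, modForm_formMatrix_self]
  push_cast
  rw [(isUnit_two_zmod_sq hp2).mul_right_eq_zero, ZMod.intCast_zmod_eq_zero_iff_dvd]
  push_cast; rfl

theorem isotropicCosets_eq_image (hp2 : p ≠ 2) {d : ℕ} (hd : 2 * d ≤ m)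
    (q : QuadraticForm ℤ (Fin m → ℤ)) (K : Fin m → ℤ) :
    isotropicCosets ((p : ℤ) ^ 2) q (elemDivMatrix p m d) K =
      (fun S : AddSubgroup (Fin m → ZMod (p ^ 2)) =>
        {N : Matrix (Fin m) (Fin m) ℤ | columnLattice N = S.comap (intRed (p ^ 2) m)}) ''
      {S | IsNeighbor p (formMatrix q) d S ∧ intRed (p ^ 2) m K ∈ S} := by
  have hp0 : (p : ℤ) ^ 2 ≠ 0 := pow_ne_zero 2 (by exact_mod_cast (Fact.out : p.Prime).ne_zero)
  ext C
  constructor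
  · rintro ⟨M, hM, hqM, ⟨L, hL⟩, rfl⟩
    rw [formCongrZero_iff _ hp0] at hqM
    obtain ⟨h1, h2⟩ := card_columnLattice_of_mem hd hM
    refine ⟨(columnLattice M).map (intRed (p ^ 2) m), ⟨⟨h1, h2, ?_⟩, ?_⟩, ?_⟩
    · rintro _ ⟨_, ⟨y, rfl⟩, rfl⟩
      exact (sq_dvd_iff_modForm hp2 q _).1 (hqM y)
    · exact ⟨K, ⟨L, hL.symm⟩, rfl⟩
    · ext N
      rw [mem_unimodularCoset_iff (det_ne_zero_of_mem hM), Set.mem_ofPred_eq,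
        comap_map_columnLattice hM]
  · rintro ⟨S, ⟨hS, hK⟩, rfl⟩
    obtain ⟨M, hM, hMS⟩ := exists_mem_doubleCoset hd hS.1 hS.2.1
    refine ⟨M, hM, ?_, ?_, ?_⟩
    · rw [formCongrZero_iff _ hp0]
      intro x
      refine (sq_dvd_iff_modForm hp2 q _).2 (hS.2.2 _ ?_)
      have : M.mulVec x ∈ columnLattice M := ⟨x, rfl⟩
      rw [hMS] at this
      exact this
    · have : K ∈ columnLattice M := by rw [hMS]; exact hK
      obtain ⟨L, hL⟩ := this
      exact ⟨L, hL.symm⟩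
    · ext N
      rw [mem_unimodularCoset_iff (det_ne_zero_of_mem hM), Set.mem_ofPred_eq, hMS]

theorem isotropicSum_eq (hp2 : p ≠ 2) {d : ℕ} (hd : 2 * d ≤ m)
    (q : QuadraticForm ℤ (Fin m → ℤ)) (K : Fin m → ℤ) :
    isotropicSum ((p : ℤ) ^ 2) q (elemDivMatrix p m d) K =
      Nat.card {S // IsNeighbor p (formMatrix q) d S ∧ intRed (p ^ 2) m K ∈ S} := by
  rw [isotropicSum, isotropicCosets_eq_image hp2 hd, Set.InjOn.ncard_image]
  · rfl
  · rintro S ⟨hS, -⟩ T ⟨hT, -⟩ hST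
    obtain ⟨M, -, hMS⟩ := exists_mem_doubleCoset hd hS.1 hS.2.1
    have hMT : columnLattice M = T.comap (intRed (p ^ 2) m) := by
      have : M ∈ {N : Matrix (Fin m) (Fin m) ℤ | columnLattice N = S.comap (intRed (p ^ 2) m)} :=
        hMS
      simp only at hST
      rw [hST] at this
      exact this
    exact AddSubgroup.comap_injective (intRed_surjective _) (hMS.symm.trans hMT)

theorem isotropicCosets_finite (hp2 : p ≠ 2) {d : ℕ} (hd : 2 * d ≤ m)
    (q : QuadraticForm ℤ (Fin m → ℤ)) (K : Fin m → ℤ) :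
    (isotropicCosets ((p : ℤ) ^ 2) q (elemDivMatrix p m d) K).Finite := by
  rw [isotropicCosets_eq_image hp2 hd]
  exact (Set.toFinite _).image _

end Cosets

/-! ### The determinant is even in odd rank. -/

section Parity

/-- Modulo `2` the matrix agrees with a skew-symmetric integral matrix, whose determinant vanishes
in odd order. -/
theorem two_dvd_det_of_odd {m : ℕ} (hm : Odd m) {Q : Matrix (Fin m) (Fin m) ℤ} (hQ : Q.IsSymm)
    (hdiag : ∀ i, 2 ∣ Q i i) : 2 ∣ Q.det := by
  let S : Matrix (Fin m) (Fin m) ℤ :=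
    Matrix.of fun i j => if i < j then Q i j else if j < i then -Q i j else 0
  have hS : S.transpose = -S := by
    ext i j
    simp only [Matrix.transpose_apply, Matrix.neg_apply, Matrix.of_apply, S]
    rcases lt_trichotomy i j with h | h | h
    · simp [h, h.not_gt, hQ.apply]
    · simp [h]
    · simp [h, h.not_gt, hQ.apply]
  have hdet : S.det = 0 := by
    have h := congrArg Matrix.det hS
    rw [Matrix.det_transpose, Matrix.det_neg, Fintype.card_fin, hm.neg_one_pow] at h
    linarith
  have hmod : Q.map (Int.castRingHom (ZMod 2)) = S.map (Int.castRingHom (ZMod 2)) := by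
    ext i j
    simp only [Matrix.map_apply, Matrix.of_apply, S, eq_intCast]
    rcases lt_trichotomy i j with h | h | h
    · simp [h]
    · subst h
      simpa using (ZMod.intCast_zmod_eq_zero_iff_dvd _ 2).2 (hdiag i)
    · simp [h, h.not_gt]
  have h2 : ((Q.det : ℤ) : ZMod 2) = 0 := by
    have := congrArg Matrix.det hmod
    rw [← RingHom.mapMatrix_apply, ← RingHom.mapMatrix_apply, ← RingHom.map_det,
      ← RingHom.map_det, hdet, map_zero] at this
    exact this
  exact_mod_cast (ZMod.intCast_zmod_eq_zero_iff_dvd _ 2).1 h2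

theorem two_dvd_formDet {k : ℕ} (q : QuadraticForm ℤ (Fin (2 * k + 1) → ℤ)) : 2 ∣ formDet q :=
  two_dvd_det_of_odd ⟨k, rfl⟩ (formMatrix_isSymm q) fun i => by
    simp [formMatrix, QuadraticMap.polar_self]

end Parity

/-! ### Frame counts for the reduced form in `2k + 1` variables. -/

section Counts

open Module

variable {p : ℕ} [Fact p.Prime] {k : ℕ} {Q : Matrix (Fin (2 * k + 1)) (Fin (2 * k + 1)) ℤ}

theorem modForm_nondegenerate {m : ℕ} {Q : Matrix (Fin m) (Fin m) ℤ} (hQp : ¬ (p : ℤ) ∣ Q.det) :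
    (modForm (ZMod p) Q).Nondegenerate := by
  apply LinearMap.BilinForm.nondegenerate_toBilin'_of_det_ne_zero'
  have h : (Q.map (Int.cast : ℤ → ZMod p)).det = ((Q.det : ℤ) : ZMod p) :=
    ((Int.castRingHom (ZMod p)).map_det Q).symm
  rwa [h, Ne, ZMod.intCast_zmod_eq_zero_iff_dvd]

theorem isotropicCount_modForm_top (hp2 : p ≠ 2) (hQ : Q.IsSymm)
    (hB : (modForm (ZMod p) Q).Nondegenerate) :
    isotropicCount (modForm (ZMod p) Q) ⊤ = p ^ (2 * k) := by
  have h := isotropicCount_top_odd (B := modForm (ZMod p) Q) (k := k)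
    (by rwa [ZMod.ringChar_zmod_n]) (modForm_isSymm hQ) hB (by simp)
  rwa [ZMod.card] at h

theorem card_frames_modForm (hp2 : p ≠ 2) (hQ : Q.IsSymm)
    (hB : (modForm (ZMod p) Q).Nondegenerate) (n : ℕ) :
    (Nat.card {w : Fin n → Fin (2 * k + 1) → ZMod p // IsFrame (modForm (ZMod p) Q) w} : ℚ) =
      ∏ i ∈ Finset.range n, ((p : ℚ) ^ (2 * k) / (p : ℚ) ^ i - (p : ℚ) ^ i) := by
  have hp0 : (p : ℚ) ≠ 0 := by exact_mod_cast (Fact.out : p.Prime).ne_zero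
  have h := card_frames (two_ne_zero_zmod hp2) (modForm_isSymm hQ) ⊤ (fun n w _ hw c => by
    obtain ⟨y, hy⟩ := exists_apply_eq hB (modForm_isSymm hQ) hw.1 c
    exact ⟨y, Submodule.mem_top, hy⟩) n
  have h3 : Nat.card (⊤ : Submodule (ZMod p) (Fin (2 * k + 1) → ZMod p)) = p ^ (2 * k + 1) := by
    rw [Nat.card_congr Submodule.topEquiv.toEquiv, Nat.card_fun, Nat.card_zmod, Nat.card_fin]
  rw [isotropicCount_modForm_top hp2 hQ hB, h3, Nat.card_zmod] at h
  simp only [Submodule.mem_top, implies_true, and_true] at h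
  rw [h]
  refine Finset.prod_congr rfl fun i _ => ?_
  push_cast
  field_simp
  ring

theorem card_frames_snoc_modForm (hp2 : p ≠ 2) (hQ : Q.IsSymm)
    (hB : (modForm (ZMod p) Q).Nondegenerate) {K : Fin (2 * k + 1) → ZMod p} (hK : K ≠ 0)
    (hKK : modForm (ZMod p) Q K K = 0) (n : ℕ) :
    (Nat.card {w : Fin n → Fin (2 * k + 1) → ZMod p //
        IsFrame (modForm (ZMod p) Q) (Fin.snoc w K : Fin (n + 1) → _)} : ℚ) =
      ∏ i ∈ Finset.range n, ((p : ℚ) ^ (2 * k) / (p : ℚ) ^ (i + 1) - (p : ℚ) ^ (i + 1)) := by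
  have hp0 : (p : ℚ) ≠ 0 := by exact_mod_cast (Fact.out : p.Prime).ne_zero
  rw [card_frames_snoc (two_ne_zero_zmod hp2) (modForm_isSymm hQ) hB hK hKK,
    isotropicCount_modForm_top hp2 hQ hB, Nat.card_zmod, Nat.card_fun, Nat.card_zmod, Nat.card_fin]
  refine Finset.prod_congr rfl fun i _ => ?_
  push_cast
  field_simp
  ring

theorem card_frames_hyperplane (hp2 : p ≠ 2) (hk : 1 ≤ k) (hQ : Q.IsSymm)
    (hQp : ¬ (p : ℤ) ∣ Q.det) {K : Fin (2 * k + 1) → ZMod p}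
    (hKK : modForm (ZMod p) Q K K ≠ 0) (n : ℕ) :
    (Nat.card {w : Fin n → Fin (2 * k + 1) → ZMod p //
        IsFrame (modForm (ZMod p) Q) w ∧ ∀ i, modForm (ZMod p) Q (w i) K = 0} : ℚ) =
      ∏ i ∈ Finset.range n, ((p : ℚ) ^ (2 * k) / (p : ℚ) ^ (i + 1) +
        quadraticChar (ZMod p) (modForm (ZMod p) Q K K) * legendreSym p ((-1) ^ k * Q.det) *
          ((p : ℚ) ^ k - (p : ℚ) ^ k / p) - (p : ℚ) ^ i) := by
  have hp0 : (p : ℚ) ≠ 0 := by exact_mod_cast (Fact.out : p.Prime).ne_zero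
  have hB := modForm_nondegenerate hQp
  have hs := modForm_isSymm (R := ZMod p) hQ
  have hsys : ∀ (n : ℕ) (w : Fin n → Fin (2 * k + 1) → ZMod p),
      (∀ i, w i ∈ LinearMap.ker (modForm (ZMod p) Q K)) → IsFrame (modForm (ZMod p) Q) w →
      ∀ c : Fin n → ZMod p, ∃ y ∈ LinearMap.ker (modForm (ZMod p) Q K),
        ∀ j, modForm (ZMod p) Q (w j) y = c j := by
    intro n w hw hf c
    -- The span of `w` is orthogonal to `K`, while `K` is not orthogonal to itself. Hence the system
    -- can be solved with the extra equation `B K y = 0`, that is, inside the hyperplane.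
    have hli : LinearIndependent (ZMod p) (Fin.cons K w : Fin (n + 1) → _) := by
      rw [linearIndependent_finCons]
      refine ⟨hf.1, fun hKw => hKK ?_⟩
      have : ∀ z ∈ Submodule.span (ZMod p) (Set.range w), modForm (ZMod p) Q K z = 0 :=
        fun z hz => Submodule.span_le.2 (Set.range_subset_iff.2 hw) hz
      exact this K hKw
    obtain ⟨y, hy⟩ := exists_apply_eq hB hs hli (Fin.cons 0 c)
    simp only [Fin.forall_fin_succ, Fin.cons_zero, Fin.cons_succ] at hy
    exact ⟨y, LinearMap.mem_ker.2 hy.1, hy.2⟩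
  have h := card_frames (two_ne_zero_zmod hp2) hs (LinearMap.ker (modForm (ZMod p) Q K)) hsys n
  have hcard : Nat.card (LinearMap.ker (modForm (ZMod p) Q K)) = p ^ (2 * k) := by
    have h1 := Module.Dual.finrank_ker_add_one_of_ne_zero (f := modForm (ZMod p) Q K)
      (fun h => hKK (by rw [h]; rfl))
    rw [Module.finrank_fin_fun] at h1
    rw [Module.natCard_eq_pow_finrank (K := ZMod p), Nat.card_zmod, Nat.add_right_cancel h1]
  have hmat : LinearMap.BilinForm.toMatrix (Pi.basisFun (ZMod p) (Fin (2 * k + 1)))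
      (modForm (ZMod p) Q) = Q.map (Int.cast : ℤ → ZMod p) := by
    rw [LinearMap.BilinForm.toMatrix_basisFun, modForm, LinearMap.BilinForm.toMatrix'_toBilin']
  have hdet : (Q.map (Int.cast : ℤ → ZMod p)).det = ((Q.det : ℤ) : ZMod p) :=
    ((Int.castRingHom (ZMod p)).map_det Q).symm
  have hN := isotropicCount_hyperplane (by rwa [ZMod.ringChar_zmod_n]) hs hk
    (Pi.basisFun (ZMod p) (Fin (2 * k + 1)))
    (by rwa [hmat, hdet, Ne, ZMod.intCast_zmod_eq_zero_iff_dvd]) hKK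
  rw [hmat, hdet, ZMod.card] at hN
  have hleg : quadraticChar (ZMod p) ((-1) ^ k * ((Q.det : ℤ) : ZMod p)) =
      legendreSym p ((-1) ^ k * Q.det) := by
    rw [legendreSym]; push_cast; rfl
  rw [hleg] at hN
  have hN' : (isotropicCount (modForm (ZMod p) Q) (LinearMap.ker (modForm (ZMod p) Q K)) : ℚ) =
      (p : ℚ) ^ (2 * k - 1) + quadraticChar (ZMod p) (modForm (ZMod p) Q K K) *
        legendreSym p ((-1) ^ k * Q.det) * ((p : ℚ) ^ k - (p : ℚ) ^ (k - 1)) := by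
    exact_mod_cast hN
  rw [hN', hcard, Nat.card_zmod] at h
  have hiff : Nat.card {w : Fin n → Fin (2 * k + 1) → ZMod p //
        IsFrame (modForm (ZMod p) Q) w ∧ ∀ i, modForm (ZMod p) Q (w i) K = 0} =
      Nat.card {w : Fin n → Fin (2 * k + 1) → ZMod p // IsFrame (modForm (ZMod p) Q) w ∧
        ∀ i, w i ∈ LinearMap.ker (modForm (ZMod p) Q K)} :=
    Nat.card_congr (Equiv.subtypeEquivRight fun w => by
      simp only [LinearMap.mem_ker, hs.eq K])
  rw [hiff, h]
  refine Finset.prod_congr rfl fun i _ => ?_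
  obtain ⟨j, rfl⟩ : ∃ j, k = j + 1 := ⟨k - 1, by omega⟩
  rw [show 2 * (j + 1) - 1 = 2 * j + 1 by omega, Nat.add_sub_cancel]
  push_cast
  field_simp
  ring

end Counts

/-! ### Numbers of subgroups containing a given vector, up to explicit factors. -/

section NeighborCounts

variable {p : ℕ} [Fact p.Prime] {m : ℕ} {Q : Matrix (Fin m) (Fin m) ℤ}

theorem card_neighbors_of_frames (hp2 : p ≠ 2) (hQ : Q.IsSymm)
    (hB : (modForm (ZMod p) Q).Nondegenerate) {d : ℕ} (R : (Fin d → Fin m → ZMod p) → Prop)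
    (P : AddSubgroup (Fin m → ZMod (p ^ 2)) → Prop) (g : ℚ)
    (hRP : ∀ v, IsLiftFrame Q v → R (red p m ∘ v) → P (frameNeighbor Q v))
    (hg : ∀ S, IsNeighbor p Q d S → P S → (Nat.card {w : Fin d → Fin m → ZMod p //
      (LinearIndependent (ZMod p) w ∧ R w) ∧
        ∀ i, w i ∈ AddSubgroup.toZModSubmodule p (S.map (red p m))} : ℚ) = g) :
    (Nat.card {w // IsFrame (modForm (ZMod p) Q) w ∧ R w} : ℚ) *
        ∏ i ∈ Finset.range d, (p : ℚ) ^ m / (p : ℚ) ^ (i + 1) =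
      Nat.card {S // IsNeighbor p Q d S ∧ P S} * (g * ((p : ℚ) ^ m / (p : ℚ) ^ d) ^ d) := by
  rw [← card_liftFrames hp2 hQ hB R]
  refine card_neighbors_mul hp2 hQ hB (fun v => R (red p m ∘ v)) P _ hRP fun S hS hPS => ?_
  rw [← hg S hS hPS]
  exact hS.card_tuples (fun w => LinearIndependent (ZMod p) w ∧ R w)

theorem IsNeighbor.card_bases {d : ℕ} {S : AddSubgroup (Fin m → ZMod (p ^ 2))}
    (hS : IsNeighbor p Q d S) :
    (Nat.card {w : Fin d → Fin m → ZMod p // LinearIndependent (ZMod p) w ∧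
      ∀ i, w i ∈ AddSubgroup.toZModSubmodule p (S.map (red p m))} : ℚ) =
      ∏ i ∈ Finset.range d, ((p : ℚ) ^ d - (p : ℚ) ^ i) := by
  have h := card_linearIndependent_in (AddSubgroup.toZModSubmodule p (S.map (red p m))) d
  have h2 : Nat.card (AddSubgroup.toZModSubmodule p (S.map (red p m))) = p ^ d := hS.2.1
  rw [h2, Nat.card_zmod] at h
  rw [h]; push_cast; rfl

theorem IsNeighbor.card_bases_snoc {n : ℕ} {S : AddSubgroup (Fin m → ZMod (p ^ 2))}
    (hS : IsNeighbor p Q (n + 1) S) {K : Fin m → ZMod p} (hK : K ≠ 0)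
    (hKS : K ∈ S.map (red p m)) :
    (Nat.card {w : Fin n → Fin m → ZMod p //
      LinearIndependent (ZMod p) (Fin.snoc w K : Fin (n + 1) → _) ∧
      ∀ i, w i ∈ AddSubgroup.toZModSubmodule p (S.map (red p m))} : ℚ) =
      ∏ i ∈ Finset.range n, ((p : ℚ) ^ (n + 1) - (p : ℚ) ^ (i + 1)) := by
  have h := card_linearIndependent_snoc_in (AddSubgroup.toZModSubmodule p (S.map (red p m))) hK
    hKS n
  have h2 : Nat.card (AddSubgroup.toZModSubmodule p (S.map (red p m))) = p ^ (n + 1) := hS.2.1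
  rw [h2, Nat.card_zmod] at h
  rw [h]; push_cast; rfl

theorem inj_mem_frameNeighbor (hQ : Q.IsSymm) {n : ℕ} {v : Fin n → Fin m → ZMod (p ^ 2)}
    {K : Fin m → ZMod p} :
    inj p m K ∈ frameNeighbor Q v ↔ ∀ i, modForm (ZMod p) Q (red p m (v i)) K = 0 := by
  rw [mem_frameNeighbor, red_inj]
  refine (and_iff_right (Submodule.zero_mem _)).trans (forall_congr' fun i => ?_)
  rw [(modForm_isSymm hQ).eq, modForm_inj, map_eq_zero_iff _ mulHom_injective,
    (modForm_isSymm hQ).eq]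

theorem IsNeighbor.orthogonal_of_inj_mem (hp2 : p ≠ 2) (hQ : Q.IsSymm) {d : ℕ}
    {S : AddSubgroup (Fin m → ZMod (p ^ 2))} (hS : IsNeighbor p Q d S) {K : Fin m → ZMod p}
    (hK : inj p m K ∈ S) {w : Fin m → ZMod p} (hw : w ∈ S.map (red p m)) :
    modForm (ZMod p) Q w K = 0 := by
  obtain ⟨x, hx, rfl⟩ := hw
  apply mulHom_injective
  rw [(modForm_isSymm hQ).eq, ← modForm_inj, hS.modForm_eq_zero hp2 hQ hK hx, map_zero]

theorem mem_map_frameNeighbor {n : ℕ} {v : Fin n → Fin m → ZMod (p ^ 2)} (hv : IsLiftFrame Q v)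
    {w : Fin m → ZMod p} : w ∈ (frameNeighbor Q v).map (red p m) ↔
      w ∈ Submodule.span (ZMod p) (Set.range (red p m ∘ v)) := by
  rw [← map_frameNeighbor hv]; rfl

theorem isFrame_snoc_iff {B : LinearMap.BilinForm (ZMod p) (Fin m → ZMod p)} (hs : B.IsSymm)
    {n : ℕ} {w : Fin n → Fin m → ZMod p} {K : Fin m → ZMod p} (hK : B K K = 0) :
    IsFrame B (Fin.snoc w K : Fin (n + 1) → _) ↔ IsFrame B w ∧
      (∀ i, B (w i) K = 0) ∧ K ∉ Submodule.span (ZMod p) (Set.range w) := by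
  simp only [IsFrame, linearIndependent_finSnoc, Fin.forall_fin_succ', Fin.snoc_castSucc,
    Fin.snoc_last]
  constructor
  · rintro ⟨⟨h1, h2⟩, h3, -⟩
    exact ⟨⟨h1, fun i => (h3 i).1⟩, fun i => (h3 i).2, h2⟩
  · rintro ⟨⟨h1, h2⟩, h3, h4⟩
    exact ⟨⟨h1, h4⟩, fun i => ⟨h2 i, h3 i⟩, fun i => by rw [hs.eq]; exact h3 i, hK⟩

theorem card_neighbors_zero (hp2 : p ≠ 2) (hQ : Q.IsSymm)
    (hB : (modForm (ZMod p) Q).Nondegenerate) (d : ℕ) :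
    (Nat.card {w : Fin d → Fin m → ZMod p // IsFrame (modForm (ZMod p) Q) w} : ℚ) *
        ∏ i ∈ Finset.range d, (p : ℚ) ^ m / (p : ℚ) ^ (i + 1) =
      Nat.card {S : AddSubgroup (Fin m → ZMod (p ^ 2)) // IsNeighbor p Q d S ∧ 0 ∈ S} *
        ((∏ i ∈ Finset.range d, ((p : ℚ) ^ d - (p : ℚ) ^ i)) *
          ((p : ℚ) ^ m / (p : ℚ) ^ d) ^ d) := by
  rw [← card_neighbors_of_frames hp2 hQ hB (fun _ => True) (fun S => 0 ∈ S) _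
    (fun v _ _ => zero_mem _) fun S hS _ => by simpa using hS.card_bases]
  simp

/-- As `S` is totally isotropic, `p K ∈ S` makes `K` orthogonal to all of `S mod p`, so every basis
of `S mod p` meets the orthogonality condition. -/
theorem card_neighbors_inj (hp2 : p ≠ 2) (hQ : Q.IsSymm)
    (hB : (modForm (ZMod p) Q).Nondegenerate) (d : ℕ) (K : Fin m → ZMod p) :
    (Nat.card {w : Fin d → Fin m → ZMod p //
        IsFrame (modForm (ZMod p) Q) w ∧ ∀ i, modForm (ZMod p) Q (w i) K = 0} : ℚ) *
        ∏ i ∈ Finset.range d, (p : ℚ) ^ m / (p : ℚ) ^ (i + 1) =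
      Nat.card {S : AddSubgroup (Fin m → ZMod (p ^ 2)) // IsNeighbor p Q d S ∧ inj p m K ∈ S} *
        ((∏ i ∈ Finset.range d, ((p : ℚ) ^ d - (p : ℚ) ^ i)) *
          ((p : ℚ) ^ m / (p : ℚ) ^ d) ^ d) := by
  refine card_neighbors_of_frames hp2 hQ hB (fun w => ∀ i, modForm (ZMod p) Q (w i) K = 0)
    (fun S => inj p m K ∈ S) _ (fun v _ h => (inj_mem_frameNeighbor hQ).2 h) fun S hS hK => ?_
  rw [← hS.card_bases]
  congr 1
  refine Nat.card_congr (Equiv.subtypeEquivRight fun w =>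
    ⟨fun h => ⟨h.1.1, h.2⟩, fun h => ⟨⟨h.1, fun i => ?_⟩, h.2⟩⟩)
  exact hS.orthogonal_of_inj_mem hp2 hQ hK (h.2 i)

theorem card_neighbors_inj_not_mem (hp2 : p ≠ 2) (hQ : Q.IsSymm)
    (hB : (modForm (ZMod p) Q).Nondegenerate) (d : ℕ) {K : Fin m → ZMod p}
    (hK : modForm (ZMod p) Q K K = 0) :
    (Nat.card {w : Fin d → Fin m → ZMod p //
        IsFrame (modForm (ZMod p) Q) (Fin.snoc w K : Fin (d + 1) → _)} : ℚ) *
        ∏ i ∈ Finset.range d, (p : ℚ) ^ m / (p : ℚ) ^ (i + 1) =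
      Nat.card {S : AddSubgroup (Fin m → ZMod (p ^ 2)) //
          (IsNeighbor p Q d S ∧ inj p m K ∈ S) ∧ ¬ K ∈ S.map (red p m)} *
        ((∏ i ∈ Finset.range d, ((p : ℚ) ^ d - (p : ℚ) ^ i)) *
          ((p : ℚ) ^ m / (p : ℚ) ^ d) ^ d) := by
  have h := card_neighbors_of_frames hp2 hQ hB (d := d)
    (fun w => (∀ i, modForm (ZMod p) Q (w i) K = 0) ∧ K ∉ Submodule.span (ZMod p) (Set.range w))
    (fun S => inj p m K ∈ S ∧ ¬ K ∈ S.map (red p m))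
    (∏ i ∈ Finset.range d, ((p : ℚ) ^ d - (p : ℚ) ^ i))
    (fun v hv h => ⟨(inj_mem_frameNeighbor hQ).2 h.1, by rw [mem_map_frameNeighbor hv]; exact h.2⟩)
    fun S hS hKS => by
      rw [← hS.card_bases]
      congr 1
      refine Nat.card_congr (Equiv.subtypeEquivRight fun w =>
        ⟨fun h => ⟨h.1.1, h.2⟩, fun h => ⟨⟨h.1, fun i => ?_, fun hw => ?_⟩, h.2⟩⟩)
      · exact hS.orthogonal_of_inj_mem hp2 hQ hKS.1 (h.2 i)
      · exact hKS.2 (Submodule.span_le.2 (Set.range_subset_iff.2 h.2) hw)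
  simp only [isFrame_snoc_iff (modForm_isSymm hQ) hK, and_assoc]
  simpa only [and_assoc] using h

/-- Bases of `S mod p` ending in `K` are used. The lift of `K` is free here, so all `n + 1` lifting
factors occur, in contrast to `card_neighbors_primitive`, where the last lift is prescribed. -/
theorem card_neighbors_inj_mem (hp2 : p ≠ 2) (hQ : Q.IsSymm)
    (hB : (modForm (ZMod p) Q).Nondegenerate) (n : ℕ) {K : Fin m → ZMod p} (hK0 : K ≠ 0) :
    (Nat.card {w : Fin n → Fin m → ZMod p //
        IsFrame (modForm (ZMod p) Q) (Fin.snoc w K : Fin (n + 1) → _)} : ℚ) *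
        ∏ i ∈ Finset.range (n + 1), (p : ℚ) ^ m / (p : ℚ) ^ (i + 1) =
      Nat.card {S : AddSubgroup (Fin m → ZMod (p ^ 2)) //
          (IsNeighbor p Q (n + 1) S ∧ inj p m K ∈ S) ∧ K ∈ S.map (red p m)} *
        ((∏ i ∈ Finset.range n, ((p : ℚ) ^ (n + 1) - (p : ℚ) ^ (i + 1))) *
          ((p : ℚ) ^ m / (p : ℚ) ^ (n + 1)) ^ (n + 1)) := by
  have h := card_neighbors_of_frames hp2 hQ hB (d := n + 1) (fun w => w (Fin.last n) = K)
    (fun S => inj p m K ∈ S ∧ K ∈ S.map (red p m))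
    (∏ i ∈ Finset.range n, ((p : ℚ) ^ (n + 1) - (p : ℚ) ^ (i + 1)))
    (fun v hv h => ⟨(inj_mem_frameNeighbor hQ).2 fun i => by
        rw [← h]; exact hv.isFrame.2 i (Fin.last n),
      (mem_map_frameNeighbor hv).2 (h ▸ Submodule.subset_span ⟨Fin.last n, rfl⟩)⟩)
    fun S hS hKS => by
      rw [← hS.card_bases_snoc hK0 hKS.2]
      congr 1
      have h1 := natCard_last_eq (fun w : Fin (n + 1) → Fin m → ZMod p =>
        LinearIndependent (ZMod p) w ∧
          ∀ i, w i ∈ AddSubgroup.toZModSubmodule p (S.map (red p m))) K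
      have h2 : ∀ w : Fin n → Fin m → ZMod p,
          (∀ i, (Fin.snoc w K : Fin (n + 1) → Fin m → ZMod p) i ∈
            AddSubgroup.toZModSubmodule p (S.map (red p m))) ↔
          ∀ i, w i ∈ AddSubgroup.toZModSubmodule p (S.map (red p m)) := fun w => by
        simp only [Fin.forall_fin_succ', Fin.snoc_castSucc, Fin.snoc_last]
        exact and_iff_left hKS.2
      simp only [h2] at h1
      rw [← h1]
      exact Nat.card_congr (Equiv.subtypeEquivRight fun w => by tauto)
  rw [natCard_last_eq] at h
  simpa only [and_assoc] using h

theorem card_neighbors_primitive (hp2 : p ≠ 2) (hQ : Q.IsSymm)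
    (hB : (modForm (ZMod p) Q).Nondegenerate) (n : ℕ) {K : Fin m → ZMod (p ^ 2)}
    (hK0 : red p m K ≠ 0) (hK : modForm (ZMod (p ^ 2)) Q K K = 0) :
    (Nat.card {w : Fin n → Fin m → ZMod p //
        IsFrame (modForm (ZMod p) Q) (Fin.snoc w (red p m K) : Fin (n + 1) → _)} : ℚ) *
        ∏ i ∈ Finset.range n, (p : ℚ) ^ m / (p : ℚ) ^ (i + 2) =
      Nat.card {S : AddSubgroup (Fin m → ZMod (p ^ 2)) // IsNeighbor p Q (n + 1) S ∧ K ∈ S} *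
        ((∏ i ∈ Finset.range n, ((p : ℚ) ^ (n + 1) - (p : ℚ) ^ (i + 1))) *
          ((p : ℚ) ^ m / (p : ℚ) ^ (n + 1)) ^ n) := by
  rw [← card_liftFrames_last hp2 hQ hB hK]
  refine card_neighbors_mul hp2 hQ hB (fun v => v (Fin.last n) = K) (fun S => K ∈ S) _
    (fun v hv h => h ▸ hv.mem (Fin.last n)) fun S hS hKS => ?_
  rw [← hS.card_bases_snoc hK0 ⟨K, hKS, rfl⟩, ← hS.card_tuples]
  congr 1
  have h1 := natCard_last_eq (fun v : Fin (n + 1) → Fin m → ZMod (p ^ 2) =>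
    (∀ i, v i ∈ S) ∧ LinearIndependent (ZMod p) (red p m ∘ v)) K
  have h2 : ∀ v : Fin n → Fin m → ZMod (p ^ 2),
      (∀ i, (Fin.snoc v K : Fin (n + 1) → Fin m → ZMod (p ^ 2)) i ∈ S) ↔ ∀ i, v i ∈ S := fun v => by
    simp only [Fin.forall_fin_succ', Fin.snoc_castSucc, Fin.snoc_last]
    exact and_iff_left hKS
  simp only [h2, red_comp_snoc, and_assoc] at h1
  exact h1

end NeighborCounts

/-! ### Solving the counting identities in terms of `α_p(d)`. -/

section Algebra

/-- After reversing the order of the product of the `P^(n+1) - P^(i+1)`, the identity holds factor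
by factor. -/
theorem alphaCoeff_mul {P : ℕ} (hP : 1 < P) {k n : ℕ} (hn : n + 1 ≤ k) :
    (∏ i ∈ Finset.range n, ((P : ℚ) ^ (2 * k) / (P : ℚ) ^ (i + 1) - (P : ℚ) ^ (i + 1))) *
        ∏ i ∈ Finset.range n, (P : ℚ) ^ (2 * k + 1) / (P : ℚ) ^ (i + 2) =
      alphaCoeff P k (n + 1) *
        ((∏ i ∈ Finset.range n, ((P : ℚ) ^ (n + 1) - (P : ℚ) ^ (i + 1))) *
          ((P : ℚ) ^ (2 * k + 1) / (P : ℚ) ^ (n + 1)) ^ n) := by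
  have hP0 : (P : ℚ) ≠ 0 := by positivity
  have hP1 : (1 : ℚ) < P := by exact_mod_cast hP
  have e1 : ∏ i ∈ Finset.range n, ((P : ℚ) ^ (n + 1) - (P : ℚ) ^ (i + 1)) =
      ∏ i ∈ Finset.range n, ((P : ℚ) ^ (n + 1) * (1 - ((P : ℚ) ^ (i + 1))⁻¹)) := by
    rw [← Finset.prod_range_reflect]
    refine Finset.prod_congr rfl fun i hi => ?_
    have hi := Finset.mem_range.1 hi
    obtain ⟨j, rfl⟩ : ∃ j, n = i + 1 + j := ⟨n - i - 1, by omega⟩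
    rw [show i + 1 + j - 1 - i + 1 = j + 1 by omega]
    field_simp
    ring
  have e2 : alphaCoeff P k (n + 1) = (∏ i ∈ Finset.range n, (P : ℚ)⁻¹) * ∏ i ∈ Finset.range n,
      ((P : ℚ) ^ (2 * k) / (P : ℚ) ^ (2 * (i + 1)) - 1) / (1 - ((P : ℚ) ^ (i + 1))⁻¹) := by
    rw [alphaCoeff, Nat.add_sub_cancel]
    congr 1
    · rw [show (1 : ℤ) - ((n + 1 : ℕ) : ℤ) = -(n : ℤ) by push_cast; ring, zpow_neg, zpow_natCast]
      simp
    · rw [show Finset.Icc 1 n = Finset.Ico 1 (n + 1) by ext; simp,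
        Finset.prod_Ico_eq_prod_range, Nat.add_sub_cancel]
      refine Finset.prod_congr rfl fun i hi => ?_
      have hi := Finset.mem_range.1 hi
      obtain ⟨j, rfl⟩ : ∃ j, k = 1 + i + j := ⟨k - 1 - i, by omega⟩
      rw [zpow_neg, zpow_natCast, Nat.add_sub_cancel_left, add_comm 1 i]
      congr 2
      rw [eq_div_iff (pow_ne_zero _ hP0), ← pow_add]
      congr 1
      omega
  have e3 : ((P : ℚ) ^ (2 * k + 1) / (P : ℚ) ^ (n + 1)) ^ n =
      ∏ i ∈ Finset.range n, ((P : ℚ) ^ (2 * k + 1) / (P : ℚ) ^ (n + 1)) := by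
    rw [Finset.prod_const, Finset.card_range]
  rw [e1, e2, e3]
  simp only [← Finset.prod_mul_distrib]
  refine Finset.prod_congr rfl fun i _ => ?_
  have h1 : (1 : ℚ) - ((P : ℚ) ^ (i + 1))⁻¹ ≠ 0 :=
    sub_ne_zero.2 (inv_lt_one_of_one_lt₀ (one_lt_pow₀ hP1 (Nat.succ_ne_zero i))).ne'
  rw [show (P : ℚ) ^ (2 * (i + 1)) = ((P : ℚ) ^ (i + 1)) ^ 2 by rw [← pow_mul, mul_comm],
    pow_succ _ (2 * k), pow_succ _ (i + 1)]
  have h2 : (P : ℚ) ^ (i + 1) ≠ 0 := pow_ne_zero _ hP0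
  have h3 : (P : ℚ) ^ (n + 1) ≠ 0 := pow_ne_zero _ hP0
  generalize (1 : ℚ) - ((P : ℚ) ^ (i + 1))⁻¹ = D at *
  generalize (P : ℚ) ^ (i + 1) = t at *
  generalize (P : ℚ) ^ (n + 1) = s at *
  field_simp

theorem prod_sub_pos {P : ℚ} (hP : 1 < P) (n : ℕ) :
    0 < ∏ i ∈ Finset.range n, (P ^ (n + 1) - P ^ (i + 1)) :=
  Finset.prod_pos fun i hi => sub_pos.2
    (pow_lt_pow_right₀ hP (by have := Finset.mem_range.1 hi; omega))

theorem count_primitive {P : ℕ} (hP : 1 < P) {k n : ℕ} (hn : n + 1 ≤ k) {X : ℚ}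
    (h : (∏ i ∈ Finset.range n, ((P : ℚ) ^ (2 * k) / (P : ℚ) ^ (i + 1) - (P : ℚ) ^ (i + 1))) *
        ∏ i ∈ Finset.range n, (P : ℚ) ^ (2 * k + 1) / (P : ℚ) ^ (i + 2) =
      X * ((∏ i ∈ Finset.range n, ((P : ℚ) ^ (n + 1) - (P : ℚ) ^ (i + 1))) *
          ((P : ℚ) ^ (2 * k + 1) / (P : ℚ) ^ (n + 1)) ^ n)) :
    X = alphaCoeff P k (n + 1) := by
  have hP1 : (1 : ℚ) < P := by exact_mod_cast hP
  rw [alphaCoeff_mul hP hn] at h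
  exact (mul_right_cancel₀ (mul_pos (prod_sub_pos hP1 n) (by positivity)).ne' h).symm

/-- Compared with `count_primitive` there is one more lifting factor on each side, `P^(2k)` on the
left and `P^(2k-n)` on the right. -/
theorem count_imprimitive_mem {P : ℕ} (hP : 1 < P) {k n : ℕ} (hn : n + 1 ≤ k) {X : ℚ}
    (h : (∏ i ∈ Finset.range n, ((P : ℚ) ^ (2 * k) / (P : ℚ) ^ (i + 1) - (P : ℚ) ^ (i + 1))) *
        ∏ i ∈ Finset.range (n + 1), (P : ℚ) ^ (2 * k + 1) / (P : ℚ) ^ (i + 1) =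
      X * ((∏ i ∈ Finset.range n, ((P : ℚ) ^ (n + 1) - (P : ℚ) ^ (i + 1))) *
          ((P : ℚ) ^ (2 * k + 1) / (P : ℚ) ^ (n + 1)) ^ (n + 1))) :
    X = alphaCoeff P k (n + 1) * (P : ℚ) ^ n := by
  have hP0 : (P : ℚ) ≠ 0 := by positivity
  have h1 : X * ((P : ℚ) ^ n)⁻¹ = alphaCoeff P k (n + 1) := by
    refine count_primitive hP hn ?_
    rw [Finset.prod_range_succ', ← mul_assoc] at h
    have h2 : (P : ℚ) ^ (2 * k + 1) / (P : ℚ) ^ (0 + 1) = (P : ℚ) ^ (2 * k) := by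
      field_simp
      ring
    have hc : (P : ℚ) ^ (2 * k + 1) / (P : ℚ) ^ (n + 1) = (P : ℚ) ^ (2 * k) * ((P : ℚ) ^ n)⁻¹ := by
      field_simp
      ring
    rw [h2] at h
    refine mul_right_cancel₀ (pow_ne_zero (2 * k) hP0) (h.trans ?_)
    rw [hc]
    ring
  rw [← h1, mul_assoc, inv_mul_cancel₀ (pow_ne_zero _ hP0), mul_one]

/-- The factor `P^(n+1) - 1` is the term `i = 0` of the basis count, absent when one basis vector is
prescribed. The ratio `r` compares the frame count with the primitive one. -/
theorem count_imprimitive {P : ℕ} (hP : 1 < P) {k n : ℕ} (hn : n + 1 ≤ k) {X r F : ℚ}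
    (hF : F = r * ∏ i ∈ Finset.range n,
      ((P : ℚ) ^ (2 * k) / (P : ℚ) ^ (i + 1) - (P : ℚ) ^ (i + 1)))
    (h : F * ∏ i ∈ Finset.range (n + 1), (P : ℚ) ^ (2 * k + 1) / (P : ℚ) ^ (i + 1) =
      X * ((∏ i ∈ Finset.range (n + 1), ((P : ℚ) ^ (n + 1) - (P : ℚ) ^ i)) *
          ((P : ℚ) ^ (2 * k + 1) / (P : ℚ) ^ (n + 1)) ^ (n + 1))) :
    X * ((P : ℚ) ^ (n + 1) - 1) = r * (alphaCoeff P k (n + 1) * (P : ℚ) ^ n) := by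
  have hP1 : (1 : ℚ) < P := by exact_mod_cast hP
  have hP0 : (P : ℚ) ≠ 0 := by positivity
  -- The value `r = 0` does occur: for `d = k` the hyperplane may contain no totally isotropic
  -- subspace of dimension `k`.
  rcases eq_or_ne r 0 with rfl | hr
  · have hpos : 0 < ∏ i ∈ Finset.range (n + 1), ((P : ℚ) ^ (n + 1) - (P : ℚ) ^ i) :=
      Finset.prod_pos fun i hi => sub_pos.2 (pow_lt_pow_right₀ hP1 (Finset.mem_range.1 hi))
    rw [hF, zero_mul, zero_mul, eq_comm, mul_eq_zero] at h
    rcases h with rfl | h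
    · simp
    · exact absurd h (mul_pos hpos (by positivity)).ne'
  · have h1 : X * ((P : ℚ) ^ (n + 1) - 1) * r⁻¹ = alphaCoeff P k (n + 1) * (P : ℚ) ^ n := by
      refine count_imprimitive_mem hP hn ?_
      refine mul_left_cancel₀ hr ?_
      rw [← mul_assoc, ← hF, h, Finset.prod_range_succ', pow_zero]
      field_simp
    rw [← h1]
    field_simp

/-- With `A = P^k`, the factors on the left are `(A - η P^i)(A / P^(i+1) + η)`, while those on the
right are `(A - η P^j)(A / P^j + η)` with `j = i + 1`. Regrouping leaves one unmatched factor at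
each end. -/
theorem prod_hyperplane {P η : ℚ} (hP : P ≠ 0) (hη : η ^ 2 = 1) (k n : ℕ) :
    ∏ i ∈ Finset.range (n + 1), (P ^ (2 * k) / P ^ (i + 1) + η * (P ^ k - P ^ k / P) - P ^ i) =
      ((P ^ k - η) * (P ^ k / P ^ (n + 1) + η)) *
        ∏ i ∈ Finset.range n, (P ^ (2 * k) / P ^ (i + 1) - P ^ (i + 1)) := by
  rw [mul_comm 2 k, pow_mul]
  generalize P ^ k = A
  induction n with
  | zero =>
    simp
    field_simp
    linear_combination P * hη
  | succ n ih =>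
    rw [Finset.prod_range_succ, ih, Finset.prod_range_succ]
    have h : (A / P ^ (n + 1) + η) * (A ^ 2 / P ^ (n + 1 + 1) + η * (A - A / P) - P ^ (n + 1)) =
        (A / P ^ (n + 1 + 1) + η) * (A ^ 2 / P ^ (n + 1) - P ^ (n + 1)) := by
      rw [pow_succ P (n + 1)]
      have ht : P ^ (n + 1) ≠ 0 := pow_ne_zero _ hP
      clear ih
      generalize P ^ (n + 1) = t at *
      field_simp
      linear_combination (A * t ^ 2 * (P - 1)) * hη
    linear_combination ((A - η) *
      ∏ i ∈ Finset.range n, (A ^ 2 / P ^ (i + 1) - P ^ (i + 1))) * h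

end Algebra

/-! ### The cases of the formula. -/

section Main

variable {p : ℕ} [Fact p.Prime] {k : ℕ}

open Classical in
theorem integralDelta_div (n : ℕ) (hn : n ≠ 0) {m : ℕ} (K : Fin m → ℤ) :
    integralDelta (fun i => (K i : ℚ) / (n : ℚ)) = if ∀ i, (n : ℤ) ∣ K i then 1 else 0 := by
  have hn' : (n : ℚ) ≠ 0 := by exact_mod_cast hn
  rw [integralDelta]
  refine if_congr (forall_congr' fun i => ⟨?_, ?_⟩) rfl rfl
  · rintro ⟨z, hz⟩
    rw [div_eq_iff hn'] at hz
    exact ⟨z, by rw [mul_comm]; exact_mod_cast hz⟩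
  · rintro ⟨z, hz⟩
    exact ⟨z, by rw [hz]; push_cast; field_simp⟩

theorem intRed_natCast_smul {m : ℕ} (x : Fin m → ℤ) :
    intRed (p ^ 2) m ((p : ℤ) • x) = inj p m (intRed p m x) := by
  ext i
  rw [inj_apply, intRed_apply, intRed_apply, mulHom_intCast]
  simp

theorem two_mul_intCast_ne_zero (hp2 : p ≠ 2) {a : ℤ} (ha : ¬ (p : ℤ) ∣ a) :
    ((2 * a : ℤ) : ZMod p) ≠ 0 := by
  push_cast
  refine mul_ne_zero (two_ne_zero_zmod hp2) ?_
  rwa [Ne, ZMod.intCast_zmod_eq_zero_iff_dvd]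

theorem epsilonSymbol_mul_formChar_sq (hp2 : p ≠ 2)
    {q : QuadraticForm ℤ (Fin (2 * k + 1) → ℤ)} (hp : ¬ (p : ℤ) ∣ formDet q)
    {K : Fin (2 * k + 1) → ℤ} (hK : ¬ (p : ℤ) ∣ q K) :
    ((epsilonSymbol p (q K) : ℚ) * formChar p q) ^ 2 = 1 := by
  have e1 : epsilonSymbol p (q K) ^ 2 = 1 :=
    legendreSym.sq_one p (two_mul_intCast_ne_zero hp2 hK)
  have e2 : formChar p q ^ 2 = 1 := by
    refine legendreSym.sq_one p ?_
    push_cast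
    refine mul_ne_zero (pow_ne_zero _ (by simp)) ?_
    rwa [Ne, ZMod.intCast_zmod_eq_zero_iff_dvd]
  rw [mul_pow]
  exact_mod_cast (by rw [e1, e2, one_mul] :
    epsilonSymbol p (q K) ^ 2 * formChar p q ^ 2 = 1)

theorem isotropicSum_primitive {d : ℕ} (hp2 : p ≠ 2) (hd : 1 ≤ d) (hdk : d ≤ k)
    (q : QuadraticForm ℤ (Fin (2 * k + 1) → ℤ)) (hp : ¬ (p : ℤ) ∣ formDet q)
    (K : Fin (2 * k + 1) → ℤ) (hK : (p : ℤ) ^ 2 ∣ q K) (hKp : ¬ ∀ i, (p : ℤ) ∣ K i) :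
    (isotropicSum ((p : ℤ) ^ 2) q (elemDivMatrix p (2 * k + 1) d) K : ℚ) = alphaCoeff p k d := by
  obtain ⟨n, rfl⟩ : ∃ n, d = n + 1 := ⟨d - 1, by omega⟩
  have hp1 := (Fact.out : p.Prime).one_lt
  have hQ := formMatrix_isSymm q
  have hB := modForm_nondegenerate hp
  have hK0 : red p (2 * k + 1) (intRed (p ^ 2) _ K) ≠ 0 := by
    rw [red_intRed]
    refine fun h => hKp fun i => ?_
    rw [← ZMod.intCast_zmod_eq_zero_iff_dvd]
    exact congrFun h i
  have hKK := (sq_dvd_iff_modForm hp2 q K).1 hK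
  rw [isotropicSum_eq hp2 (by omega)]
  have h := card_neighbors_primitive hp2 hQ hB n hK0 hKK
  rw [card_frames_snoc_modForm hp2 hQ hB hK0 (by rw [← redHom_modForm, hKK, map_zero])] at h
  exact count_primitive hp1 hdk h

theorem isotropicSum_zero {d : ℕ} (hp2 : p ≠ 2) (hd : 1 ≤ d) (hdk : d ≤ k)
    (q : QuadraticForm ℤ (Fin (2 * k + 1) → ℤ)) (hp : ¬ (p : ℤ) ∣ formDet q)
    (K : Fin (2 * k + 1) → ℤ) (hK : intRed (p ^ 2) _ K = 0) :
    (isotropicSum ((p : ℤ) ^ 2) q (elemDivMatrix p (2 * k + 1) d) K : ℚ) * ((p : ℚ) ^ d - 1) =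
      ((p : ℚ) ^ (2 * k) - 1) * (alphaCoeff p k d * (p : ℚ) ^ (d - 1)) := by
  obtain ⟨n, rfl⟩ : ∃ n, d = n + 1 := ⟨d - 1, by omega⟩
  have hp1 := (Fact.out : p.Prime).one_lt
  have hQ := formMatrix_isSymm q
  have hB := modForm_nondegenerate hp
  rw [isotropicSum_eq hp2 (by omega), hK]
  refine count_imprimitive hp1 hdk ?_ (card_neighbors_zero hp2 hQ hB (n + 1))
  rw [card_frames_modForm hp2 hQ hB, Finset.prod_range_succ']
  simp [mul_comm]

theorem isotropicSum_imprimitive_of_ne_zero {d : ℕ} (hp2 : p ≠ 2) (hd : 1 ≤ d) (hdk : d ≤ k)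
    (q : QuadraticForm ℤ (Fin (2 * k + 1) → ℤ)) (hp : ¬ (p : ℤ) ∣ formDet q)
    (K : Fin (2 * k + 1) → ℤ) (hK : ¬ (p : ℤ) ∣ q K) :
    (isotropicSum ((p : ℤ) ^ 2) q (elemDivMatrix p (2 * k + 1) d) ((p : ℤ) • K) : ℚ) *
        ((p : ℚ) ^ d - 1) =
      (((p : ℚ) ^ k - epsilonSymbol p (q K) * formChar p q) *
        ((p : ℚ) ^ k / (p : ℚ) ^ d + epsilonSymbol p (q K) * formChar p q)) *
        (alphaCoeff p k d * (p : ℚ) ^ (d - 1)) := by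
  obtain ⟨n, rfl⟩ : ∃ n, d = n + 1 := ⟨d - 1, by omega⟩
  have hp1 := (Fact.out : p.Prime).one_lt
  have hp0 : (p : ℚ) ≠ 0 := by positivity
  have hQ := formMatrix_isSymm q
  have hB := modForm_nondegenerate hp
  have hval : modForm (ZMod p) (formMatrix q) (intRed p _ K) (intRed p _ K) =
      ((2 * q K : ℤ) : ZMod p) := by
    rw [modForm_intRed, modForm_formMatrix_self]
  have heps : quadraticChar (ZMod p) ((2 * q K : ℤ) : ZMod p) = epsilonSymbol p (q K) := rfl
  have hη := epsilonSymbol_mul_formChar_sq hp2 hp hK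
  rw [isotropicSum_eq hp2 (by omega), intRed_natCast_smul]
  refine count_imprimitive hp1 hdk ?_ (card_neighbors_inj hp2 hQ hB (n + 1) (intRed p _ K))
  rw [card_frames_hyperplane hp2 (by omega) hQ hp (by rw [hval]; exact two_mul_intCast_ne_zero hp2 hK),
    hval, heps]
  exact prod_hyperplane hp0 hη k n

/-- The subgroups with `K` in `S mod p` contribute `p^d - 1` to the coefficient and the others
`p^(2k-d) - p^d`; the terms `p^d` cancel. -/
theorem isotropicSum_imprimitive_of_eq_zero {d : ℕ} (hp2 : p ≠ 2) (hd : 1 ≤ d) (hdk : d ≤ k)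
    (q : QuadraticForm ℤ (Fin (2 * k + 1) → ℤ)) (hp : ¬ (p : ℤ) ∣ formDet q)
    (K : Fin (2 * k + 1) → ℤ) (hKp : ¬ ∀ i, (p : ℤ) ∣ K i) (hK : (p : ℤ) ∣ q K) :
    (isotropicSum ((p : ℤ) ^ 2) q (elemDivMatrix p (2 * k + 1) d) ((p : ℤ) • K) : ℚ) *
        ((p : ℚ) ^ d - 1) =
      ((p : ℚ) ^ (2 * k) / (p : ℚ) ^ d - 1) * (alphaCoeff p k d * (p : ℚ) ^ (d - 1)) := by
  obtain ⟨n, rfl⟩ : ∃ n, d = n + 1 := ⟨d - 1, by omega⟩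
  have hp1 := (Fact.out : p.Prime).one_lt
  have hQ := formMatrix_isSymm q
  have hB := modForm_nondegenerate hp
  have hK0 : intRed p _ K ≠ 0 := by
    refine fun h => hKp fun i => ?_
    rw [← ZMod.intCast_zmod_eq_zero_iff_dvd]
    exact congrFun h i
  have hKK : modForm (ZMod p) (formMatrix q) (intRed p _ K) (intRed p _ K) = 0 := by
    rw [modForm_intRed, modForm_formMatrix_self, ZMod.intCast_zmod_eq_zero_iff_dvd]
    exact dvd_mul_of_dvd_right hK 2
  rw [isotropicSum_eq hp2 (by omega), intRed_natCast_smul,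
    natCard_subtype_split _ fun S => intRed p _ K ∈ S.map (red p (2 * k + 1))]
  have h1 := card_neighbors_inj_mem hp2 hQ hB n hK0
  have h2 := card_neighbors_inj_not_mem hp2 hQ hB (n + 1) hKK
  rw [card_frames_snoc_modForm hp2 hQ hB hK0 hKK] at h1 h2
  have h3 := count_imprimitive_mem hp1 hdk h1
  have h4 := count_imprimitive hp1 hdk (by rw [Finset.prod_range_succ, mul_comm]) h2
  push_cast
  rw [add_mul, h4, h3]
  ring

end Main

end IsotropicSum

/-- In the symbol `ε_p(q(p⁻¹ K))` the number `q(p⁻¹ K) = q(K) / p²` is an integer by the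
hypothesis on `K`, so the integer division below is exact. -/
theorem theorem1p9 (k d p : ℕ) [Fact p.Prime] (hd : 1 ≤ d) (hdk : d ≤ k)
    (q : QuadraticForm ℤ (Fin (2 * k + 1) → ℤ))
    (hq : IsotropicSum.formDet q ≠ 0)
    (hp : ¬ (p : ℤ) ∣ IsotropicSum.formDet q)
    (K : Fin (2 * k + 1) → ℤ) (hK : (p : ℤ) ^ 2 ∣ q K) :
    (IsotropicSum.isotropicCosets ((p : ℤ) ^ 2) q
        (IsotropicSum.elemDivMatrix p (2 * k + 1) d) K).Finite ∧
    (IsotropicSum.isotropicSum ((p : ℤ) ^ 2) q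
        (IsotropicSum.elemDivMatrix p (2 * k + 1) d) K : ℚ) =
      IsotropicSum.alphaCoeff p k d *
        (1 +
          ((IsotropicSum.epsilonSymbol p (q K / (p : ℤ) ^ 2) : ℚ) *
              (IsotropicSum.formChar p q : ℚ) * (p : ℚ) ^ (k - 1) +
            IsotropicSum.kappaCoeff p k d) *
            IsotropicSum.integralDelta (fun i => (K i : ℚ) / (p : ℚ)) +
          (p : ℚ) ^ (2 * k + 1 - 2) *
            IsotropicSum.integralDelta (fun i => (K i : ℚ) / (p : ℚ) ^ 2)) := by
  open IsotropicSum in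
  have hprime := (Fact.out : p.Prime)
  have hp2 : p ≠ 2 := by
    rintro rfl
    exact hp (by exact_mod_cast two_dvd_formDet q)
  refine ⟨isotropicCosets_finite hp2 (by omega) q K, ?_⟩
  have hp0 : (p : ℚ) ≠ 0 := by exact_mod_cast hprime.ne_zero
  have hpz : (p : ℤ) ≠ 0 := by exact_mod_cast hprime.ne_zero
  have hp1 : (1 : ℚ) < p := by exact_mod_cast hprime.one_lt
  have hd1 : (p : ℚ) ^ d - 1 ≠ 0 := (sub_pos.2 (one_lt_pow₀ hp1 (by omega))).ne'
  have hδ1 := integralDelta_div p hprime.ne_zero K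
  have hδ2 := integralDelta_div (p ^ 2) (pow_ne_zero 2 hprime.ne_zero) K
  push_cast at hδ2
  obtain ⟨n, rfl⟩ : ∃ n, d = n + 1 := ⟨d - 1, by omega⟩
  obtain ⟨j, rfl⟩ : ∃ j, k = j + 1 := ⟨k - 1, by omega⟩
  rw [hδ1, hδ2, kappaCoeff, show 2 * (j + 1) + 1 - 2 = 2 * j + 1 by omega]
  by_cases hKp : ∀ i, (p : ℤ) ∣ K i
  · obtain ⟨K, rfl⟩ : ∃ K', K = (p : ℤ) • K' := by
      choose K' hK' using hKp
      exact ⟨K', funext hK'⟩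
    rw [if_pos hKp, QuadraticMap.map_smul, smul_eq_mul, ← sq,
      Int.mul_ediv_cancel_left _ (pow_ne_zero 2 hpz)]
    -- From here on `K` denotes the original column divided by `p`.
    by_cases hKp2 : ∀ i, (p : ℤ) ∣ K i
    · have h1 : ∀ i, (p : ℤ) ^ 2 ∣ ((p : ℤ) • K) i := fun i => by
        rw [sq]; exact mul_dvd_mul_left _ (hKp2 i)
      have hqK : (p : ℤ) ∣ q K := by
        obtain ⟨K', rfl⟩ : ∃ K', K = (p : ℤ) • K' := by
          choose K' hK' using hKp2
          exact ⟨K', funext hK'⟩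
        rw [QuadraticMap.map_smul, smul_eq_mul, mul_assoc]
        exact dvd_mul_right _ _
      have hε : epsilonSymbol p (q K) = 0 := by
        rw [epsilonSymbol, legendreSym.eq_zero_iff, ZMod.intCast_zmod_eq_zero_iff_dvd]
        exact dvd_mul_of_dvd_right hqK 2
      have h := isotropicSum_zero hp2 hd hdk q hp ((p : ℤ) • K) (funext fun i => by
        rw [intRed_apply, Pi.zero_apply, ZMod.intCast_zmod_eq_zero_iff_dvd]
        exact_mod_cast h1 i)
      rw [if_pos h1, hε]
      -- What remains is `1 + κ_p(d) + p^(2k-1) = p^(d-1) (p^(2k) - 1) / (p^d - 1)`.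
      refine mul_right_cancel₀ hd1 (h.trans ?_)
      rw [Nat.add_sub_cancel]
      field_simp
      push_cast
      ring
    · have h1 : ¬ ∀ i, (p : ℤ) ^ 2 ∣ ((p : ℤ) • K) i := fun h => hKp2 fun i => by
        have := h i
        rw [sq] at this
        exact Int.dvd_of_mul_dvd_mul_left hpz this
      rw [if_neg h1]
      by_cases hqK : (p : ℤ) ∣ q K
      · have hε : epsilonSymbol p (q K) = 0 := by
          rw [epsilonSymbol, legendreSym.eq_zero_iff, ZMod.intCast_zmod_eq_zero_iff_dvd]
          exact dvd_mul_of_dvd_right hqK 2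
        rw [hε]
        have h := isotropicSum_imprimitive_of_eq_zero hp2 hd hdk q hp K hKp2 hqK
        refine mul_right_cancel₀ hd1 (h.trans ?_)
        rw [Nat.add_sub_cancel]
        field_simp
        push_cast
        ring
      · have h := isotropicSum_imprimitive_of_ne_zero hp2 hd hdk q hp K hqK
        have h2 := epsilonSymbol_mul_formChar_sq hp2 hp hqK
        refine mul_right_cancel₀ hd1 (h.trans ?_)
        rw [Nat.add_sub_cancel]
        generalize (epsilonSymbol p (q K) : ℚ) * formChar p q = η at *
        field_simp
        push_cast
        -- Expanding `(p^k - η)(p^(k-d) + η)`, the relation `η² = 1` gives the constant term and the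
        -- cross terms give `η p^(k-1)` after division by `p^d - 1`.
        linear_combination (-alphaCoeff p (j + 1) (n + 1) * (p : ℚ) ^ n * (p : ℚ) ^ (n + 1)) * h2
  · have h1 : ¬ ∀ i, (p : ℤ) ^ 2 ∣ K i := fun h => hKp fun i =>
      (dvd_pow_self _ two_ne_zero).trans (h i)
    rw [if_neg hKp, if_neg h1, isotropicSum_primitive hp2 hd hdk q hp K hK hKp]
    ring
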